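/- Let $q_0,q_1,q_2\in\mathbb R^2$ be the vertices of an equilateral triangle, $F_i$ the homothety with ratio $1/2$ and fixed point $q_i$, and $\mathcal{SG}$ the Sierpinski gasket, i.e. the unique nonempty compact set with $\mathcal{SG}=\bigcup_{i=0}^2F_i(\mathcal{SG})$. For a word $w=(w_1,\dots,w_m)\in\{0,1,2\}^m$ put $F_w=F_{w_1}\circ\cdots\circ F_{w_m}$, and call $C_w=F_w(\mathcal{SG})$ a cell of level $m$. Let $V_m=\{F_wq_i: |w|=m,\ 0\le i\le 2\}$, so $V_0=\{q_0,q_1,q_2\}$; write $x\sim_m y$ if $x\ne y$ and $x,y\in F_w(V_0)$ for some word $w$ of length $m$. Let $\mu$ be the self-similar probability measure on $\mathcal{SG}$ giving mass $3^{-m}$ to each cell of level $m$. A continuous function $h:\mathcal{SG}\to\mathbb R$ is harmonic if $h(x)=\frac14\sum_{y\sim_m x}h(y)$ for all $m$ and all $x\in V_m\setminus V_0$. Let $W=\{a\in\mathbb R^3: a_i\ge 0,\ a_0+a_1+a_2=1\}$ and $\pi_W=\{a\in\mathbb R^3: a_0+a_1+a_2=1\}$. Then there is a set $\widetilde W$ with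 $W\subseteq\widetilde W\subseteq\pi_W$ such that the following holds for every cell $C_w$ that does not meet $V_0$. Let $p_i=F_wq_i$. (a) For each $i$ there is exactly one cell $C_i$ of the same level as $C_w$ with $C_i\cap C_w=\{p_i\}$. Put $D_w=C_w\cup C_0\cup C_1\cup C_2$, let $\rho$ be the distance from $p_0$ to the line through $p_1$ and $p_2$, and for $c=(c_0,c_1,c_2)\in[0,1]^3$ let $$B(c_0,c_1,c_2)=C_w\cup E_0\cup E_1\cup E_2,$$ where $E_i$ is the part of $C_i$ between $p_i$ and the line that is orthogonal to the symmetry axis of $C_i$ through $p_i$ and lies at distance $c_i\rho$ from $p_i$ (points on the line included). Let $\mathcal B=\{B(c): c\in[0,1]^3\}$ and $\mathcal B^*=\{B(c): c\in[0,1]^3,\ c_i=0 \text{ for some } i\}$. (b) The sets $B(c)$, $c\in[0,1]^3$, are pairwise distinct, and $C_w\subseteq B\subseteq D_w$ for every $B\in\mathcal B$. (c) For every $B\in\mathcal B$ there is exactly one vector $\mathcal T(B)=(a_0,a_1,a_2)\in\mathbb R^3$ such that $$\frac1{\mu(B)}\int_B h\,d\mu=\sum_{i=0}^2a_ih(p_i)\quad\text{for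 every harmonic function } h .$$ (d) $\mathcal T(\mathcal B)=\widetilde W$; in particular $\mathcal T(\mathcal B)\supseteq W$. (e) $\mathcal T$ maps $\mathcal B^*$ one-to-one onto $\widetilde W$. -/

import Mathlib

open MeasureTheory Set

namespace SGasket

noncomputable section

/-- The Euclidean plane. -/
abbrev Plane : Type := EuclideanSpace ℝ (Fin 2)

/-- `q 0, q 1, q 2` are the vertices of a (nondegenerate) equilateral triangle. -/
def IsEquilateral (q : Fin 3 → Plane) : Prop :=
  ∃ l : ℝ, 0 < l ∧ ∀ i j : Fin 3, i ≠ j → dist (q i) (q j) = l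

/-- The homothety `F_i` with ratio `1/2` and fixed point `q i`. -/
def F (q : Fin 3 → Plane) (i : Fin 3) : Plane → Plane :=
  fun x => AffineMap.homothety (q i) (1 / 2 : ℝ) x

/-- `F_w = F_{w_1} ∘ ⋯ ∘ F_{w_m}`. -/
def Fw (q : Fin 3 → Plane) : List (Fin 3) → Plane → Plane
  | [] => id
  | i :: w => F q i ∘ Fw q w

/-- The address map: `addr q ω` is the limit of `F_{ω 0} ∘ ⋯ ∘ F_{ω n} (x)` as `n → ∞`. -/
def addr (q : Fin 3 → Plane) (ω : ℕ → Fin 3) : Plane :=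
  ∑' k : ℕ, (1 / 2 : ℝ) ^ (k + 1) • q (ω k)

/-- The Sierpinski gasket with corners `q i`, as the set of all points that have an address.
It is the attractor of the three homotheties: see `SG_isCompact`, `SG_nonempty`,
`SG_eq_iUnion` and `SG_unique`. -/
def SG (q : Fin 3 → Plane) : Set Plane := range (addr q)

/-- The self-similar probability measure giving mass `3⁻ᵐ` to every cell of level `m`: the image
under the address map of the uniform Bernoulli measure on addresses. -/
def mu (q : Fin 3 → Plane) : Measure Plane :=
  (Measure.infinitePi fun _ : ℕ => (PMF.uniformOfFintype (Fin 3)).toMeasure).map (addr q)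

/-- The cell `C_w = F_w(SG)`. -/
def cell (q : Fin 3 → Plane) (w : List (Fin 3)) : Set Plane := Fw q w '' SG q

/-- The boundary point `p_i = F_w q_i` of the cell `C_w`. -/
def corner (q : Fin 3 → Plane) (w : List (Fin 3)) (i : Fin 3) : Plane := Fw q w (q i)

/-- The vertex set `V_m` of the graph `Γ_m`. In particular `V_0 = {q_0, q_1, q_2}`. -/
def V (q : Fin 3 → Plane) (m : ℕ) : Set Plane :=
  {x | ∃ w : List (Fin 3), w.length = m ∧ ∃ i, x = corner q w i}

/-- The edge relation `x ∼_m y` of `Γ_m`: distinct boundary points of a common `m`-cell. -/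
def Adj (q : Fin 3 → Plane) (m : ℕ) (x y : Plane) : Prop :=
  x ≠ y ∧ ∃ w : List (Fin 3), w.length = m ∧ (∃ i, x = corner q w i) ∧ ∃ j, y = corner q w j

/-- Harmonic functions on the gasket (only the values on `SG q` matter): continuous, and
`h(x) = (1/4) ∑_{y ∼_m x} h(y)` for every `m` and every nonboundary `x ∈ V_m`. -/
def IsHarmonic (q : Fin 3 → Plane) (h : Plane → ℝ) : Prop :=
  ContinuousOn h (SG q) ∧
    ∀ m : ℕ, ∀ x ∈ V q m \ V q 0, h x = (1 / 4) * ∑ᶠ y ∈ {y | Adj q m x y}, h y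

/-- `C_v` is a neighbor of `C_w` at `p_i`: a cell of the same level meeting `C_w` exactly in
`p_i`. -/
def IsNeighbor (q : Fin 3 → Plane) (w : List (Fin 3)) (i : Fin 3) (v : List (Fin 3)) : Prop :=
  v.length = w.length ∧ cell q v ∩ cell q w = {corner q w i}

/-- `D_w`: the union of `C_w` and its neighbors. -/
def D (q : Fin 3 → Plane) (w : List (Fin 3)) : Set Plane :=
  cell q w ∪ ⋃ (i : Fin 3) (v : List (Fin 3)) (_ : IsNeighbor q w i v), cell q v

/-- The size `ρ` of `C_w`: the distance from `p_0` to the line through `p_1` and `p_2`. -/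
def size (q : Fin 3 → Plane) (w : List (Fin 3)) : ℝ :=
  Metric.infDist (corner q w 0) (line[ℝ, corner q w 1, corner q w 2] : Set Plane)

/-- The unit vector at the point `p` pointing to the center of the triangle spanned by the corners
of `C_v`. If `p` is a corner of `C_v`, it spans the symmetry axis of `C_v` through `p`. -/
def axisDir (q : Fin 3 → Plane) (v : List (Fin 3)) (p : Plane) : Plane :=
  let u : Plane := (1 / 3 : ℝ) • (corner q v 0 + corner q v 1 + corner q v 2) - p
  ‖u‖⁻¹ • u

/-- The part of `C_v` between its corner `p` and the line orthogonal to the symmetry axis through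
`p` at distance `t` from `p`. -/
def cut (q : Fin 3 → Plane) (v : List (Fin 3)) (p : Plane) (t : ℝ) : Set Plane :=
  {x ∈ cell q v | inner ℝ (x - p) (axisDir q v p) ≤ t}

/-- `E_i ⊆ C_i`, cut off at distance `c ρ` from `p_i`. (The union is over the neighbors of `C_w` at
`p_i`; if `C_w` misses `V_0`, there is exactly one.) -/
def E (q : Fin 3 → Plane) (w : List (Fin 3)) (i : Fin 3) (c : ℝ) : Set Plane :=
  ⋃ (v : List (Fin 3)) (_ : IsNeighbor q w i v), cut q v (corner q w i) (c * size q w)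

/-- `B(c_0, c_1, c_2) = C_w ∪ E_0 ∪ E_1 ∪ E_2`. -/
def B (q : Fin 3 → Plane) (w : List (Fin 3)) (c : Fin 3 → ℝ) : Set Plane :=
  cell q w ∪ ⋃ i : Fin 3, E q w i (c i)

/-- The parameter cube `Λ`. -/
def Lam : Set (Fin 3 → ℝ) := {c | ∀ i, 0 ≤ c i ∧ c i ≤ 1}

/-- The parameters of the two-neighbor sets: some `c_i` is zero. -/
def LamStar : Set (Fin 3 → ℝ) := {c ∈ Lam | ∃ i, c i = 0}

/-- The family of all sets `B(c_0, c_1, c_2)`. -/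
def family (q : Fin 3 → Plane) (w : List (Fin 3)) : Set (Set Plane) := B q w '' Lam

/-- The subfamily of the sets that use at most two neighbors. -/
def familyStar (q : Fin 3 → Plane) (w : List (Fin 3)) : Set (Set Plane) := B q w '' LamStar

/-- `a` is a coefficient vector of `S` relative to `C_w`: `M_S(h) = ∑ a_i h(p_i)` for all harmonic
`h`, where `M_S(h)` is the mean value of `h` over `S`. -/
def IsCoeff (q : Fin 3 → Plane) (w : List (Fin 3)) (S : Set Plane) (a : Fin 3 → ℝ) : Prop :=
  ∀ h : Plane → ℝ, IsHarmonic q h → ⨍ x in S, h x ∂(mu q) = ∑ i, a i * h (corner q w i)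

/-- The plane `π_W` in `ℝ³` containing the triangle `W = stdSimplex ℝ (Fin 3)`. -/
def planeW : Set (Fin 3 → ℝ) := {a | ∑ i, a i = 1}

/-! The address set is the attractor of the three homotheties, and `mu` is a probability measure. -/

theorem F_apply (q : Fin 3 → Plane) (i : Fin 3) (x : Plane) :
    F q i x = (1 / 2 : ℝ) • q i + (1 / 2 : ℝ) • x := by
  simp only [F, AffineMap.homothety_apply, vsub_eq_sub, vadd_eq_add]
  module

theorem norm_term_le (q : Fin 3 → Plane) (ω : ℕ → Fin 3) (k : ℕ) :
    ‖(1 / 2 : ℝ) ^ (k + 1) • q (ω k)‖ ≤ (1 / 2 : ℝ) ^ k * ∑ i, ‖q i‖ := by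
  have h1 : ‖q (ω k)‖ ≤ ∑ i, ‖q i‖ :=
    Finset.single_le_sum (f := fun i => ‖q i‖) (fun i _ => norm_nonneg _) (Finset.mem_univ _)
  rw [norm_smul, Real.norm_of_nonneg (by positivity)]
  have h2 : (1 / 2 : ℝ) ^ (k + 1) ≤ (1 / 2 : ℝ) ^ k :=
    pow_le_pow_of_le_one (by norm_num) (by norm_num) (Nat.le_succ k)
  gcongr

theorem summable_bound (q : Fin 3 → Plane) :
    Summable fun k : ℕ => (1 / 2 : ℝ) ^ k * ∑ i, ‖q i‖ :=
  summable_geometric_two.mul_right _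

theorem addr_continuous (q : Fin 3 → Plane) : Continuous (addr q) := by
  refine continuous_tsum (fun k => ?_) (summable_bound q) (fun k ω => norm_term_le q ω k)
  have h : Continuous fun ω : ℕ → Fin 3 => q (ω k) :=
    Continuous.comp (g := q) continuous_of_discreteTopology (continuous_apply k)
  exact h.const_smul ((1 / 2 : ℝ) ^ (k + 1))

theorem addr_eq (q : Fin 3 → Plane) (ω : ℕ → Fin 3) :
    addr q ω = F q (ω 0) (addr q fun k => ω (k + 1)) := by
  have hs : Summable fun k : ℕ => (1 / 2 : ℝ) ^ (k + 1) • q (ω k) :=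
    Summable.of_norm_bounded (summable_bound q) (norm_term_le q ω)
  have hs' : Summable fun k : ℕ => (1 / 2 : ℝ) ^ (k + 1) • q (ω (k + 1)) :=
    Summable.of_norm_bounded (summable_bound q) (norm_term_le q fun k => ω (k + 1))
  rw [F_apply, addr, addr, hs.tsum_eq_zero_add, ← hs'.tsum_const_smul]
  simp [pow_succ', smul_smul]

theorem SG_isCompact (q : Fin 3 → Plane) : IsCompact (SG q) :=
  isCompact_range (addr_continuous q)

theorem SG_nonempty (q : Fin 3 → Plane) : (SG q).Nonempty := range_nonempty _

theorem SG_eq_iUnion (q : Fin 3 → Plane) : SG q = ⋃ i, F q i '' SG q := by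
  apply Subset.antisymm
  · rintro _ ⟨ω, rfl⟩
    exact mem_iUnion.2 ⟨ω 0, _, ⟨fun k => ω (k + 1), rfl⟩, (addr_eq q ω).symm⟩
  · refine iUnion_subset fun i => ?_
    rintro _ ⟨_, ⟨ω, rfl⟩, rfl⟩
    let ω' : ℕ → Fin 3 := fun k => Nat.casesOn k i ω
    have h : addr q ω' = F q (ω' 0) (addr q fun k => ω' (k + 1)) := addr_eq q ω'
    exact ⟨ω', h⟩

theorem dist_F (q : Fin 3 → Plane) (i : Fin 3) (x y : Plane) :
    dist (F q i x) (F q i y) = (1 / 2) * dist x y := by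
  rw [F_apply, F_apply, dist_add_left, dist_smul₀, Real.norm_of_nonneg (by norm_num)]

/-- If `K` is covered by its images and `L` is stable under the maps, then `K ⊆ L`. -/
theorem attractor_le (q : Fin 3 → Plane) (K L : Set Plane) (hK : IsCompact K) (hL : IsCompact L)
    (hL0 : L.Nonempty) (hK2 : K ⊆ ⋃ i, F q i '' K) (hL2 : (⋃ i, F q i '' L) ⊆ L) : K ⊆ L := by
  rcases K.eq_empty_or_nonempty with rfl | hK0
  · exact empty_subset _
  obtain ⟨x, hxK, hx⟩ :=
    hK.exists_isMaxOn hK0 (Metric.continuous_infDist_pt L).continuousOn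
  obtain ⟨i, y, hy, rfl⟩ := mem_iUnion.1 (hK2 hxK)
  obtain ⟨z, hz, hyz⟩ := hL.exists_infDist_eq_dist hL0 y
  have h1 : Metric.infDist (F q i y) L ≤ dist (F q i y) (F q i z) :=
    Metric.infDist_le_dist_of_mem (hL2 (mem_iUnion.2 ⟨i, z, hz, rfl⟩))
  rw [dist_F, ← hyz] at h1
  have h2 : Metric.infDist y L ≤ Metric.infDist (F q i y) L := hx hy
  have h3 : Metric.infDist (F q i y) L ≤ 0 := by linarith
  intro t ht
  have h4 : Metric.infDist t L ≤ Metric.infDist (F q i y) L := hx ht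
  exact (hL.isClosed.mem_iff_infDist_zero hL0).2
    (le_antisymm (h4.trans h3) Metric.infDist_nonneg)

theorem SG_unique (q : Fin 3 → Plane) (K : Set Plane) (hK : IsCompact K) (hK0 : K.Nonempty)
    (hK2 : K = ⋃ i, F q i '' K) : K = SG q :=
  Subset.antisymm
    (attractor_le q K _ hK (SG_isCompact q) (SG_nonempty q) hK2.subset (SG_eq_iUnion q).superset)
    (attractor_le q _ K (SG_isCompact q) hK hK0 (SG_eq_iUnion q).subset hK2.superset)

instance (q : Fin 3 → Plane) : IsProbabilityMeasure (mu q) :=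
  Measure.isProbabilityMeasure_map (addr_continuous q).measurable.aemeasurable

end

end SGasket

namespace SGasket

/-! ### Addresses and words -/

/-! Everything is pulled back to the space of addresses. Mean values over $B(c)$ then reduce to two
functions of one variable: `mass c`, the mass of the part of the gasket within normalized height $c$
of a vertex, and `moment c`, the integral over that part of the harmonic function with corner values
0, 1, 1. Harmonic functions correspond to triples of corner values, refined by the 1/5-2/5 rule
(`IsHarmonic.eq_harmonicAddr`, `isHarmonic_harmonicExt`). By reflection symmetry, an integral over a
cut-off part depends only on the value at the vertex and the mean of the other two corner values
(`cutIntegral_eq`). Harmonicity at $p_i$ expresses the corner sum of the neighbor through the values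
on $C_w$ (`sum_extendWord_neighbor`). With `weight` $=$ `mass` $+\frac32$ `moment`, `totalMass`
$M=1+\sum_i$ `mass` $(c_i)$ and ratios $r_j=$ `weight` $(c_j)/M$, the coefficient vector is
$\frac13+r_j-\frac13\sum_i r_i$ (`setIntegral_B`). It does not involve $w$, so $\widetilde W$ can be
taken as the image of `coeff`. The coefficients determine the ratios up to a common additive
constant. On `LamStar` the smallest ratio is 0, so the ratios themselves are determined. They
determine $c$ because `weight` increases strictly and `moment/mass` is nondecreasing
(`moment_mul_mass_le`): a larger $M$ would require larger parameters, but then the masses could not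
grow fast enough to produce that $M$ (`coeff_injOn`). For surjectivity, subtracting the least weight
from all three preserves the coefficients up to normalization. The intermediate value theorem
restores the normalization by scaling the remaining weights (`exists_ratio_eq`,
`coeff_image_LamStar`). The same scaling realizes every point of the simplex
(`stdSimplex_subset_coeff_image`). -/

/-- Prepend a letter to an address. -/
def cons (i : Fin 3) (ω : ℕ → Fin 3) : ℕ → Fin 3 := fun k => Nat.casesOn k i ω

theorem cons_tail (ω : ℕ → Fin 3) : cons (ω 0) (fun k => ω (k + 1)) = ω := by
  funext k
  cases k <;> rfl

theorem continuous_cons (i : Fin 3) : Continuous (cons i) := by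
  refine continuous_pi fun k => ?_
  cases k with
  | zero => exact continuous_const
  | succ k => exact continuous_apply k

theorem addr_cons (q : Fin 3 → Plane) (i : Fin 3) (ω : ℕ → Fin 3) :
    addr q (cons i ω) = F q i (addr q ω) := addr_eq q (cons i ω)

theorem F_injective (q : Fin 3 → Plane) (i : Fin 3) : Function.Injective (F q i) := by
  intro x y h
  have := dist_F q i x y
  rw [h, dist_self] at this
  exact dist_eq_zero.1 (by linarith)

theorem F_self (q : Fin 3 → Plane) (i : Fin 3) : F q i (q i) = q i := by
  rw [F_apply, ← add_smul]
  norm_num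

theorem F_comm (q : Fin 3 → Plane) (i j : Fin 3) : F q i (q j) = F q j (q i) := by
  rw [F_apply, F_apply, add_comm]

theorem F_mem_SG (q : Fin 3 → Plane) (i : Fin 3) {x : Plane} (hx : x ∈ SG q) :
    F q i x ∈ SG q := by
  rw [SG_eq_iUnion]
  exact mem_iUnion.2 ⟨i, x, hx, rfl⟩

theorem addr_const (q : Fin 3 → Plane) (i : Fin 3) : addr q (fun _ => i) = q i := by
  have h := addr_eq q (fun _ => i)
  have h2 := dist_F q i (addr q fun _ => i) (q i)
  rw [F_self] at h2
  simp only at h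
  rw [← h] at h2
  exact dist_eq_zero.1 (by linarith)

theorem vertex_mem_SG (q : Fin 3 → Plane) (i : Fin 3) : q i ∈ SG q := ⟨_, addr_const q i⟩

theorem continuous_F (q : Fin 3 → Plane) (i : Fin 3) : Continuous (F q i) := by
  have : F q i = fun x => (1 / 2 : ℝ) • q i + (1 / 2 : ℝ) • x := funext (F_apply q i)
  rw [this]
  fun_prop

theorem Fw_cons (q : Fin 3 → Plane) (i : Fin 3) (w : List (Fin 3)) (x : Plane) :
    Fw q (i :: w) x = F q i (Fw q w x) := rfl

theorem Fw_append (q : Fin 3 → Plane) (u w : List (Fin 3)) (x : Plane) :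
    Fw q (u ++ w) x = Fw q u (Fw q w x) := by
  induction u with
  | nil => rfl
  | cons i u ih => simp only [List.cons_append, Fw_cons, ih]

theorem Fw_injective (q : Fin 3 → Plane) (w : List (Fin 3)) : Function.Injective (Fw q w) := by
  induction w with
  | nil => exact Function.injective_id
  | cons i w ih => exact (F_injective q i).comp ih

theorem continuous_Fw (q : Fin 3 → Plane) (w : List (Fin 3)) : Continuous (Fw q w) := by
  induction w with
  | nil => exact continuous_id
  | cons i w ih => exact (continuous_F q i).comp ih

theorem Fw_mem_SG (q : Fin 3 → Plane) (w : List (Fin 3)) {x : Plane} (hx : x ∈ SG q) :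
    Fw q w x ∈ SG q := by
  induction w with
  | nil => exact hx
  | cons i w ih => exact F_mem_SG q i ih

theorem Fw_sub (q : Fin 3 → Plane) (w : List (Fin 3)) (x y : Plane) :
    Fw q w x - Fw q w y = (1 / 2 : ℝ) ^ w.length • (x - y) := by
  induction w with
  | nil => simp [Fw]
  | cons i w ih =>
    rw [Fw_cons, Fw_cons, F_apply, F_apply, add_sub_add_left_eq_sub, ← smul_sub, ih, smul_smul,
      List.length_cons, pow_succ']

theorem Fw_replicate (q : Fin 3 → Plane) (i : Fin 3) (n : ℕ) :
    Fw q (List.replicate n i) (q i) = q i := by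
  induction n with
  | zero => rfl
  | succ n ih => rw [List.replicate_succ, Fw_cons, ih, F_self]

theorem isCompact_cell (q : Fin 3 → Plane) (w : List (Fin 3)) : IsCompact (cell q w) :=
  (SG_isCompact q).image (continuous_Fw q w)

theorem cell_subset_SG (q : Fin 3 → Plane) (w : List (Fin 3)) : cell q w ⊆ SG q := by
  rintro _ ⟨x, hx, rfl⟩
  exact Fw_mem_SG q w hx

theorem corner_mem_cell (q : Fin 3 → Plane) (w : List (Fin 3)) (i : Fin 3) :
    corner q w i ∈ cell q w := ⟨_, vertex_mem_SG q i, rfl⟩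

theorem mem_V_zero (q : Fin 3 → Plane) {x : Plane} : x ∈ V q 0 ↔ ∃ i, x = q i := by
  constructor
  · rintro ⟨w, hw, i, rfl⟩
    rw [List.length_eq_zero_iff.1 hw]
    exact ⟨i, rfl⟩
  · rintro ⟨i, rfl⟩
    exact ⟨[], rfl, i, rfl⟩

/-! ### Barycentric coordinates -/

/-- The center of the triangle. -/
noncomputable def center (q : Fin 3 → Plane) : Plane := (1 / 3 : ℝ) • (q 0 + q 1 + q 2)

/-- The barycentric coordinates with respect to an equilateral triangle. -/
noncomputable def bary (q : Fin 3 → Plane) (i : Fin 3) (x : Plane) : ℝ :=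
  1 / 3 + 2 / dist (q 0) (q 1) ^ 2 * inner ℝ (x - center q) (q i - center q)

/-- Two edge vectors from $q_0$ have squared length $l^2$ and inner product $l^2/2$, which
determines the rest. The values $l^2/3$ and $-l^2/6$ explain the factor $2/l^2$ in `bary`: they give
it the values 1 and 0 at the vertices. -/
theorem gram_center {q : Fin 3 → Plane} (hq : IsEquilateral q) (i j : Fin 3) :
    inner ℝ (q i - center q) (q j - center q) =
      if i = j then dist (q 0) (q 1) ^ 2 / 3 else -(dist (q 0) (q 1) ^ 2 / 6) := by
  obtain ⟨l, -, hl⟩ := hq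
  have h10 := hl 1 0 (by decide)
  have h20 := hl 2 0 (by decide)
  have h12 := hl 1 2 (by decide)
  rw [hl 0 1 (by decide)]
  rw [dist_eq_norm] at h10 h20 h12
  have e1 : inner ℝ (q 1 - q 0) (q 1 - q 0) = l ^ 2 := by rw [real_inner_self_eq_norm_sq, h10]
  have e2 : inner ℝ (q 2 - q 0) (q 2 - q 0) = l ^ 2 := by rw [real_inner_self_eq_norm_sq, h20]
  have e3 : inner ℝ ((q 1 - q 0) - (q 2 - q 0)) ((q 1 - q 0) - (q 2 - q 0)) = l ^ 2 := by
    rw [sub_sub_sub_cancel_right, real_inner_self_eq_norm_sq, h12]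
  have d0 : q 0 - center q = (-1 / 3 : ℝ) • (q 1 - q 0) + (-1 / 3 : ℝ) • (q 2 - q 0) := by
    rw [center]; module
  have d1 : q 1 - center q = (2 / 3 : ℝ) • (q 1 - q 0) + (-1 / 3 : ℝ) • (q 2 - q 0) := by
    rw [center]; module
  have d2 : q 2 - center q = (-1 / 3 : ℝ) • (q 1 - q 0) + (2 / 3 : ℝ) • (q 2 - q 0) := by
    rw [center]; module
  generalize q 1 - q 0 = v at *
  generalize q 2 - q 0 = v' at *
  rw [inner_sub_left, inner_sub_right, inner_sub_right, e1, e2, real_inner_comm v v'] at e3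
  have e4 : inner ℝ v v' = l ^ 2 / 2 := by
    have := real_inner_comm v v'
    linarith
  have e5 : inner ℝ v' v = l ^ 2 / 2 := by rw [real_inner_comm, e4]
  fin_cases i <;> fin_cases j <;>
    simp only [Fin.zero_eta, Fin.mk_one, Fin.reduceFinMk, d0, d1, d2, inner_add_left,
      inner_add_right, real_inner_smul_left, real_inner_smul_right, e1, e2, e4, e5] <;>
    simp <;> ring

theorem dist_pos_of_isEquilateral {q : Fin 3 → Plane} (hq : IsEquilateral q) :
    0 < dist (q 0) (q 1) := by
  obtain ⟨l, hl0, hl⟩ := hq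
  rwa [hl 0 1 (by decide)]

theorem bary_vertex {q : Fin 3 → Plane} (hq : IsEquilateral q) (i j : Fin 3) :
    bary q i (q j) = if i = j then 1 else 0 := by
  have h0 := (dist_pos_of_isEquilateral hq).ne'
  rw [bary, gram_center hq]
  by_cases h : i = j
  · rw [if_pos h.symm, if_pos h]
    field_simp
    norm_num
  · rw [if_neg (Ne.symm h), if_neg h]
    field_simp
    norm_num

theorem sum_bary (q : Fin 3 → Plane) (x : Plane) : ∑ i, bary q i x = 1 := by
  have h : (q 0 - center q) + (q 1 - center q) + (q 2 - center q) = 0 := by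
    rw [center]; module
  have h2 : inner ℝ (x - center q) ((q 0 - center q) + (q 1 - center q) + (q 2 - center q)) = 0 := by
    rw [h, inner_zero_right]
  rw [inner_add_right, inner_add_right] at h2
  simp only [bary, Fin.sum_univ_three]
  linear_combination 2 / dist (q 0) (q 1) ^ 2 * h2

theorem bary_F (q : Fin 3 → Plane) (i j : Fin 3) (x : Plane) :
    bary q i (F q j x) = (bary q i (q j) + bary q i x) / 2 := by
  have h : F q j x - center q =
      (1 / 2 : ℝ) • (q j - center q) + (1 / 2 : ℝ) • (x - center q) := by
    rw [F_apply]; module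
  rw [bary, h, inner_add_left, real_inner_smul_left, real_inner_smul_left, bary, bary]
  ring

theorem continuous_bary (q : Fin 3 → Plane) (i : Fin 3) : Continuous (bary q i) := by
  unfold bary
  fun_prop

theorem bary_combination {q : Fin 3 → Plane} (hq : IsEquilateral q) (t : Fin 3 → ℝ)
    (ht : ∑ i, t i = 1) (i : Fin 3) : bary q i (∑ j, t j • q j) = t i := by
  have h : ∑ j, t j • q j - center q = ∑ j, t j • (q j - center q) := by
    simp only [smul_sub, Finset.sum_sub_distrib, ← Finset.sum_smul, ht, one_smul]
  have h2 : ∀ j, inner ℝ (q j - center q) (q i - center q) =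
      dist (q 0) (q 1) ^ 2 / 2 * (bary q i (q j) - 1 / 3) := by
    intro j
    have h0 := (dist_pos_of_isEquilateral hq).ne'
    rw [bary]
    field_simp
    ring
  have h0 := (dist_pos_of_isEquilateral hq).ne'
  rw [bary, h, sum_inner]
  simp only [real_inner_smul_left, h2, bary_vertex hq]
  rw [Fin.sum_univ_three] at *
  fin_cases i <;> simp <;> field_simp <;> linarith

/-- The full triangle is compact and stable under the three homotheties, so `attractor_le` applies.
The resulting bounds on `bary` are the geometric input for all intersections of cells. -/
theorem SG_subset_simplex (q : Fin 3 → Plane) :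
    SG q ⊆ (fun t : Fin 3 → ℝ => ∑ j, t j • q j) '' stdSimplex ℝ (Fin 3) := by
  have hc : Continuous fun t : Fin 3 → ℝ => ∑ j, t j • q j := by fun_prop
  have hn : (stdSimplex ℝ (Fin 3)).Nonempty := ⟨_, single_mem_stdSimplex ℝ 0⟩
  refine attractor_le q _ _ (SG_isCompact q) ((isCompact_stdSimplex ℝ (Fin 3)).image hc)
    (hn.image _) (SG_eq_iUnion q).subset ?_
  refine iUnion_subset fun i => ?_
  rintro _ ⟨_, ⟨t, ht, rfl⟩, rfl⟩
  refine ⟨(1 / 2 : ℝ) • Pi.single i 1 + (1 / 2 : ℝ) • t,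
    convex_stdSimplex ℝ (Fin 3) (single_mem_stdSimplex ℝ i) ht (by norm_num) (by norm_num)
      (by norm_num), ?_⟩
  simp only [F_apply, Pi.add_apply, Pi.smul_apply, smul_eq_mul, add_smul, Finset.sum_add_distrib,
    mul_smul, ← Finset.smul_sum]
  congr 2
  simp [Pi.single_apply]

theorem SG_eq_combination {q : Fin 3 → Plane} (hq : IsEquilateral q) {x : Plane} (hx : x ∈ SG q) :
    x = ∑ j, bary q j x • q j := by
  obtain ⟨t, ht, rfl⟩ := SG_subset_simplex q hx
  simp only [bary_combination hq t ht.2]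

theorem bary_nonneg {q : Fin 3 → Plane} (hq : IsEquilateral q) {x : Plane} (hx : x ∈ SG q)
    (i : Fin 3) : 0 ≤ bary q i x := by
  obtain ⟨t, ht, rfl⟩ := SG_subset_simplex q hx
  simp only [bary_combination hq t ht.2]
  exact ht.1 i

theorem bary_le_one {q : Fin 3 → Plane} (hq : IsEquilateral q) {x : Plane} (hx : x ∈ SG q)
    (i : Fin 3) : bary q i x ≤ 1 := by
  rw [← sum_bary q x]
  exact Finset.single_le_sum (f := fun i => bary q i x) (fun j _ => bary_nonneg hq hx j)
    (Finset.mem_univ i)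

theorem eq_vertex_of_bary {q : Fin 3 → Plane} (hq : IsEquilateral q) {x : Plane} (hx : x ∈ SG q)
    {i : Fin 3} (h : 1 ≤ bary q i x) : x = q i := by
  have h1 := le_antisymm (bary_le_one hq hx i) h
  have hs := sum_bary q x
  rw [← Finset.add_sum_erase _ _ (Finset.mem_univ i), h1] at hs
  have h0 : ∑ j ∈ Finset.univ.erase i, bary q j x = 0 := by linarith
  rw [Finset.sum_eq_zero_iff_of_nonneg fun j _ => bary_nonneg hq hx j] at h0
  rw [SG_eq_combination hq hx, ← Finset.add_sum_erase _ _ (Finset.mem_univ i), h1, one_smul,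
    Finset.sum_eq_zero, add_zero]
  intro j hj
  rw [h0 j hj, zero_smul]

theorem vertex_injective {q : Fin 3 → Plane} (hq : IsEquilateral q) : Function.Injective q := by
  intro i j h
  have h1 := bary_vertex hq i i
  rw [h, bary_vertex hq, if_pos rfl] at h1
  by_contra hne
  rw [if_neg hne] at h1
  norm_num at h1

theorem corner_injective {q : Fin 3 → Plane} (hq : IsEquilateral q) (w : List (Fin 3)) :
    Function.Injective (corner q w) := (Fw_injective q w).comp (vertex_injective hq)

/-! ### Intersections of cells -/

theorem eq_of_F_eq_vertex {q : Fin 3 → Plane} (hq : IsEquilateral q) {x : Plane} (hx : x ∈ SG q)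
    {a i : Fin 3} (h : F q a x = q i) : a = i ∧ x = q i := by
  have h1 := congrArg (bary q i) h
  rw [bary_F, bary_vertex hq, bary_vertex hq, if_pos rfl] at h1
  have h2 := bary_le_one hq hx i
  have hai : a = i := by
    by_contra hne
    rw [if_neg (Ne.symm hne)] at h1
    linarith
  subst hai
  exact ⟨rfl, F_injective q a (by rw [h, F_self])⟩

theorem eq_of_Fw_eq_vertex {q : Fin 3 → Plane} (hq : IsEquilateral q) {x : Plane} (hx : x ∈ SG q)
    {w : List (Fin 3)} {i : Fin 3} (h : Fw q w x = q i) :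
    w = List.replicate w.length i ∧ x = q i := by
  induction w with
  | nil => exact ⟨rfl, h⟩
  | cons a w ih =>
    obtain ⟨rfl, h2⟩ := eq_of_F_eq_vertex hq (Fw_mem_SG q w hx) h
    obtain ⟨h3, h4⟩ := ih h2
    exact ⟨by rw [List.length_cons, List.replicate_succ, ← h3], h4⟩

/-- The coordinate `bary q a` is at least 1/2 on $F_a(\mathcal{SG})$ and at most 1/2 on
$F_b(\mathcal{SG})$, with equality on the latter only at $F_b q_a$. The same holds with $a$ and $b$
exchanged. -/
theorem eq_vertex_of_F_eq_F {q : Fin 3 → Plane} (hq : IsEquilateral q) {x y : Plane}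
    (hx : x ∈ SG q) (hy : y ∈ SG q) {a b : Fin 3} (hab : a ≠ b) (h : F q a x = F q b y) :
    x = q b ∧ y = q a := by
  have h1 := congrArg (bary q a) h
  have h2 := congrArg (bary q b) h
  rw [bary_F, bary_F, bary_vertex hq, bary_vertex hq, if_pos rfl, if_neg hab] at h1
  rw [bary_F, bary_F, bary_vertex hq, bary_vertex hq, if_pos rfl, if_neg hab.symm] at h2
  have h3 := bary_nonneg hq hx a
  have h4 := bary_nonneg hq hy b
  exact ⟨eq_vertex_of_bary hq hx (by linarith), eq_vertex_of_bary hq hy (by linarith)⟩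

/-- Two different cells of the same level can only meet in corners. -/
theorem exists_vertex_of_Fw_eq_Fw {q : Fin 3 → Plane} (hq : IsEquilateral q) {x y : Plane}
    (hx : x ∈ SG q) (hy : y ∈ SG q) {w v : List (Fin 3)} (hl : w.length = v.length) (hwv : w ≠ v)
    (h : Fw q w x = Fw q v y) : ∃ i, x = q i := by
  induction w generalizing v with
  | nil => exact absurd (List.length_eq_zero_iff.1 hl.symm).symm hwv
  | cons a w ih =>
    cases v with
    | nil => simp at hl
    | cons b v =>
      by_cases hab : a = b
      · subst hab
        exact ih (by simpa using hl) (fun h => hwv (by rw [h])) (F_injective q a h)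
      · obtain ⟨h1, -⟩ := eq_vertex_of_F_eq_F hq (Fw_mem_SG q w hx) (Fw_mem_SG q v hy) hab h
        exact ⟨b, (eq_of_Fw_eq_vertex hq hx h1).2⟩

/-- The addresses of a corner of a cell. -/
theorem eq_of_Fw_eq_corner {q : Fin 3 → Plane} (hq : IsEquilateral q) {y : Plane} (hy : y ∈ SG q)
    {a i : Fin 3} (hai : a ≠ i) {n : ℕ} {u v : List (Fin 3)} (hl : v.length = u.length + n + 1)
    (h : Fw q v y = corner q (u ++ a :: List.replicate n i) i) :
    (v = u ++ a :: List.replicate n i ∧ y = q i) ∨ (v = u ++ i :: List.replicate n a ∧ y = q a) := by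
  -- The corner is $F_uF_aq_i=F_uF_iq_a$. Its only addresses are $u\,a\,i\,i\,i\ldots$ and
  -- $u\,i\,a\,a\,a\ldots$, and $v$ must be an initial segment of one of them.
  rw [corner, Fw_append, Fw_cons, Fw_replicate] at h
  induction u generalizing v with
  | nil =>
    cases v with
    | nil => simp at hl
    | cons b v =>
      have hv : v.length = n := by simpa using hl
      by_cases hba : b = a
      · subst hba
        obtain ⟨h1, h2⟩ := eq_of_Fw_eq_vertex hq hy (F_injective q b h)
        left
        rw [hv] at h1
        exact ⟨by rw [h1]; rfl, h2⟩
      · obtain ⟨h1, h2⟩ := eq_vertex_of_F_eq_F hq (Fw_mem_SG q v hy) (vertex_mem_SG q i) hba h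
        obtain ⟨h3, h4⟩ := eq_of_Fw_eq_vertex hq hy h1
        right
        rw [hv] at h3
        exact ⟨by rw [h3, vertex_injective hq h2]; rfl, h4⟩
  | cons c u ih =>
    cases v with
    | nil => simp at hl
    | cons d v =>
      by_cases hdc : d = c
      · subst hdc
        have := ih (v := v) (by simp at hl; omega) (F_injective q d h)
        simpa using this
      · obtain ⟨-, h2⟩ := eq_vertex_of_F_eq_F hq (Fw_mem_SG q v hy)
          (Fw_mem_SG q u (F_mem_SG q a (vertex_mem_SG q i))) hdc h
        obtain ⟨-, h3⟩ := eq_of_Fw_eq_vertex hq (F_mem_SG q a (vertex_mem_SG q i)) h2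
        obtain ⟨h4, h5⟩ := eq_of_F_eq_vertex hq (vertex_mem_SG q i) h3
        exact absurd (h4.trans (vertex_injective hq h5).symm) hai

theorem corner_eq_corner_neighbor (q : Fin 3 → Plane) (u : List (Fin 3)) (a i : Fin 3) (n : ℕ) :
    corner q (u ++ a :: List.replicate n i) i = corner q (u ++ i :: List.replicate n a) a := by
  simp only [corner, Fw_append, Fw_cons, Fw_replicate, F_comm q a i]

/-- The neighbor of a cell at a corner. -/
theorem isNeighbor_iff {q : Fin 3 → Plane} (hq : IsEquilateral q) {a i : Fin 3} (hai : a ≠ i)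
    (n : ℕ) (u v : List (Fin 3)) :
    IsNeighbor q (u ++ a :: List.replicate n i) i v ↔ v = u ++ i :: List.replicate n a := by
  constructor
  · rintro ⟨hl, h⟩
    have hmem : corner q (u ++ a :: List.replicate n i) i ∈ cell q v :=
      (h.superset rfl).1
    obtain ⟨y, hy, hyc⟩ := hmem
    rcases eq_of_Fw_eq_corner hq hy hai (by simpa [add_assoc] using hl) hyc with h1 | h1
    · exfalso
      rw [h1.1, inter_self] at h
      have h2 := h.subset (corner_mem_cell q _ a)
      exact hai (corner_injective hq _ h2)
    · exact h1.1
  · rintro rfl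
    refine ⟨by simp, Subset.antisymm ?_ ?_⟩
    · rintro _ ⟨⟨x, hx, rfl⟩, ⟨y, hy, h⟩⟩
      rw [Fw_append, Fw_append] at h
      have h1 := Fw_injective q u h
      obtain ⟨h2, -⟩ := eq_vertex_of_F_eq_F hq (Fw_mem_SG q _ hy) (Fw_mem_SG q _ hx) hai h1
      rw [Fw_append, ← h, Fw_cons, h2, mem_singleton_iff, corner, Fw_append, Fw_cons, Fw_replicate]
    · rw [singleton_subset_iff]
      refine ⟨?_, corner_mem_cell q _ i⟩
      rw [corner_eq_corner_neighbor]
      exact corner_mem_cell q _ a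

theorem exists_word_decomposition (w : List (Fin 3)) (i : Fin 3) :
    w = List.replicate w.length i ∨
      ∃ u a n, a ≠ i ∧ w = u ++ a :: List.replicate n i := by
  induction w with
  | nil => left; rfl
  | cons b w ih =>
    rcases ih with h | ⟨u, a, n, hai, h⟩
    · by_cases hb : b = i
      · left
        rw [List.length_cons, List.replicate_succ, ← h, hb]
      · right
        exact ⟨[], b, w.length, hb, by rw [← h]; rfl⟩
    · right
      exact ⟨b :: u, a, n, hai, by rw [h]; rfl⟩

theorem exists_word_decomposition_of_disjoint {q : Fin 3 → Plane} {w : List (Fin 3)}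
    (hw : cell q w ∩ V q 0 = ∅) (i : Fin 3) :
    ∃ u a n, a ≠ i ∧ w = u ++ a :: List.replicate n i := by
  refine (exists_word_decomposition w i).resolve_left fun h => ?_
  have h1 : q i ∈ cell q w := ⟨q i, vertex_mem_SG q i, by rw [h, Fw_replicate]⟩
  exact (hw.subset ⟨h1, (mem_V_zero q).2 ⟨i, rfl⟩⟩ : q i ∈ (∅ : Set Plane))

/-! ### The cut-off parts of a cell -/

theorem norm_vertex_sub_center_sq {q : Fin 3 → Plane} (hq : IsEquilateral q) (i : Fin 3) :
    ‖q i - center q‖ ^ 2 = dist (q 0) (q 1) ^ 2 / 3 := by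
  rw [← real_inner_self_eq_norm_sq, gram_center hq, if_pos rfl]

theorem inner_sub_vertex_center {q : Fin 3 → Plane} (hq : IsEquilateral q) (i : Fin 3)
    (y : Plane) :
    inner ℝ (y - q i) (center q - q i) = dist (q 0) (q 1) ^ 2 / 2 * (1 - bary q i y) := by
  have h0 := (dist_pos_of_isEquilateral hq).ne'
  have h1 : y - q i = (y - center q) - (q i - center q) := by abel
  have h2 : center q - q i = -(q i - center q) := by abel
  rw [h1, h2, inner_neg_right, inner_sub_left, gram_center hq, if_pos rfl, bary]
  field_simp
  ring

/-- The size of a cell is `3/2` times the distance of its corners to its center. -/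
theorem size_eq {q : Fin 3 → Plane} (hq : IsEquilateral q) (w : List (Fin 3)) (i : Fin 3) :
    size q w = (1 / 2 : ℝ) ^ w.length * (3 / 2 * ‖q i - center q‖) := by
  have hn : ∀ j, ‖q j - center q‖ = ‖q 0 - center q‖ := fun j => by
    have h1 := norm_vertex_sub_center_sq hq j
    rw [← norm_vertex_sub_center_sq hq 0] at h1
    exact (pow_left_inj₀ (norm_nonneg _) (norm_nonneg _) two_ne_zero).1 h1
  have hd := dist_pos_of_isEquilateral hq
  have hpos : 0 < ‖q 0 - center q‖ := by
    refine norm_pos_iff.2 fun h => ?_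
    have h1 := norm_vertex_sub_center_sq hq 0
    rw [h, norm_zero] at h1
    nlinarith
  rw [hn i, size]
  have hmid : Fw q w ((1 / 2 : ℝ) • q 1 + (1 / 2 : ℝ) • q 2) ∈
      (line[ℝ, corner q w 1, corner q w 2] : Set Plane) := by
    have h1 : Fw q w ((1 / 2 : ℝ) • q 1 + (1 / 2 : ℝ) • q 2) =
        AffineMap.lineMap (corner q w 1) (corner q w 2) (1 / 2 : ℝ) := by
      rw [AffineMap.lineMap_apply, vsub_eq_sub, vadd_eq_add, corner, corner, Fw_sub,
        ← sub_eq_iff_eq_add, Fw_sub, smul_comm]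
      congr 1
      module
    rw [h1]
    exact AffineMap.lineMap_mem_affineSpan_pair _ _ _
  apply le_antisymm
  · refine (Metric.infDist_le_dist_of_mem hmid).trans_eq ?_
    have h1 : q 0 - ((1 / 2 : ℝ) • q 1 + (1 / 2 : ℝ) • q 2) = (3 / 2 : ℝ) • (q 0 - center q) := by
      rw [center]; module
    rw [corner, dist_eq_norm, Fw_sub, h1, norm_smul, norm_smul, Real.norm_of_nonneg (by positivity),
      Real.norm_of_nonneg (by norm_num)]
  · rw [Metric.le_infDist ⟨_, hmid⟩]
    intro x hx
    obtain ⟨t, rfl⟩ := mem_affineSpan_pair_iff_exists_lineMap_eq.1 hx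
    have h1 : corner q w 0 - AffineMap.lineMap (corner q w 1) (corner q w 2) t =
        (1 / 2 : ℝ) ^ w.length • ((q 0 - q 1) - t • (q 2 - q 1)) := by
      rw [AffineMap.lineMap_apply, vsub_eq_sub, vadd_eq_add, corner, corner, corner, Fw_sub,
        sub_add_eq_sub_sub_swap, Fw_sub]
      module
    -- The component normal to the opposite side is the same for every point of that line, so
    -- Cauchy–Schwarz bounds the distance from below.
    have h2 : inner ℝ ((q 0 - q 1) - t • (q 2 - q 1)) (q 0 - center q) =
        3 / 2 * ‖q 0 - center q‖ ^ 2 := by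
      have e : (q 0 - q 1) - t • (q 2 - q 1) = (q 0 - center q) + (t - 1) • (q 1 - center q)
          - t • (q 2 - center q) := by module
      rw [e, inner_sub_left, inner_add_left, real_inner_smul_left, real_inner_smul_left,
        norm_vertex_sub_center_sq hq]
      simp only [gram_center hq]
      simp
      ring
    have h3 := real_inner_le_norm ((q 0 - q 1) - t • (q 2 - q 1)) (q 0 - center q)
    rw [h2] at h3
    rw [dist_eq_norm, h1, norm_smul, Real.norm_of_nonneg (by positivity)]
    gcongr
    nlinarith

/-- Measured along the axis in units of the cell size, the distance from the corner is $1-$ `bary`.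
Cells of equal level have equal size, so the cut becomes a condition on the whole gasket that is
independent of the level. -/
theorem cut_eq {q : Fin 3 → Plane} (hq : IsEquilateral q) {v w : List (Fin 3)}
    (hl : v.length = w.length) (a : Fin 3) (c : ℝ) :
    cut q v (corner q v a) (c * size q w) = Fw q v '' {y ∈ SG q | 1 - bary q a y ≤ c} := by
  have hd := dist_pos_of_isEquilateral hq
  have hnsq := norm_vertex_sub_center_sq hq a
  have hpos : 0 < ‖q a - center q‖ := by
    refine norm_pos_iff.2 fun h => ?_
    rw [h, norm_zero] at hnsq
    nlinarith
  have hu : (1 / 3 : ℝ) • (corner q v 0 + corner q v 1 + corner q v 2) - corner q v a =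
      (1 / 2 : ℝ) ^ v.length • (center q - q a) := by
    have e : (1 / 3 : ℝ) • (corner q v 0 + corner q v 1 + corner q v 2) - corner q v a =
      (1 / 3 : ℝ) • ((corner q v 0 - corner q v a) + (corner q v 1 - corner q v a) +
        (corner q v 2 - corner q v a)) := by module
    rw [e]
    simp only [corner, Fw_sub, center]
    module
  have key : ∀ y, inner ℝ (Fw q v y - corner q v a) (axisDir q v (corner q v a)) ≤ c * size q w ↔
      1 - bary q a y ≤ c := by
    intro y
    have e : inner ℝ (Fw q v y - corner q v a) (axisDir q v (corner q v a)) =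
        (1 - bary q a y) * size q w := by
      rw [axisDir]
      simp only [hu]
      rw [corner, Fw_sub, real_inner_smul_left, real_inner_smul_right, real_inner_smul_right,
        inner_sub_vertex_center hq, size_eq hq w a, norm_smul, norm_sub_rev,
        Real.norm_of_nonneg (by positivity), hl]
      have h2 : dist (q 0) (q 1) ^ 2 = 3 * ‖q a - center q‖ ^ 2 := by linarith
      rw [h2]
      field_simp
    have hs : 0 < size q w := by
      rw [size_eq hq w a]
      positivity
    rw [e]
    exact mul_le_mul_iff_left₀ hs
  ext x
  constructor
  · rintro ⟨⟨y, hy, rfl⟩, h⟩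
    exact ⟨y, ⟨hy, (key y).1 h⟩, rfl⟩
  · rintro ⟨y, ⟨hy, h⟩, rfl⟩
    exact ⟨⟨y, hy, rfl⟩, (key y).2 h⟩

/-! ### Harmonic extension on the address space -/

/-- The `1/5`-`2/5` rule: the corner values on the cell `C_i` of the harmonic function with corner
values `h`. -/
noncomputable def extend (i : Fin 3) (h : Fin 3 → ℝ) : Fin 3 → ℝ :=
  fun j => if j = i then h i else (h i + h j + ∑ k, h k) / 5

/-- The corner values on the cell `C_w` of the harmonic function with corner values `h`. -/
noncomputable def extendWord : List (Fin 3) → (Fin 3 → ℝ) → Fin 3 → ℝ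
  | [], h => h
  | i :: w, h => extendWord w (extend i h)

/-- The corner values on the `n`-th cell around the point with address `ω`. -/
noncomputable def stage (h : Fin 3 → ℝ) (ω : ℕ → Fin 3) : ℕ → Fin 3 → ℝ
  | 0 => h
  | n + 1 => extend (ω n) (stage h ω n)

/-- The value at the point with address `ω` of the harmonic function with corner values `h`. -/
noncomputable def harmonicAddr (h : Fin 3 → ℝ) (ω : ℕ → Fin 3) : ℝ :=
  h 0 + ∑' n, (stage h ω (n + 1) 0 - stage h ω n 0)

theorem extend_self (i : Fin 3) (h : Fin 3 → ℝ) : extend i h i = h i := if_pos rfl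

theorem extend_of_ne {i j : Fin 3} (hij : j ≠ i) (h : Fin 3 → ℝ) :
    extend i h j = (h i + h j + ∑ k, h k) / 5 := if_neg hij

theorem extend_comm {i j : Fin 3} (h : Fin 3 → ℝ) : extend i h j = extend j h i := by
  by_cases hij : j = i
  · rw [hij]
  · rw [extend_of_ne hij, extend_of_ne (Ne.symm hij), add_comm (h i)]

theorem sum_extend (i : Fin 3) (h : Fin 3 → ℝ) :
    ∑ j, extend i h j = (6 * h i + 3 * ∑ j, h j) / 5 := by
  fin_cases i <;> simp [extend, Fin.sum_univ_three] <;> ring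

theorem extend_add (i : Fin 3) (h k : Fin 3 → ℝ) : extend i (h + k) = extend i h + extend i k := by
  funext j
  simp only [extend, Pi.add_apply, Finset.sum_add_distrib]
  split_ifs <;> ring

theorem extend_smul (i : Fin 3) (c : ℝ) (h : Fin 3 → ℝ) : extend i (c • h) = c • extend i h := by
  funext j
  simp only [extend, Pi.smul_apply, smul_eq_mul, ← Finset.mul_sum]
  split_ifs <;> ring

theorem extend_perm (σ : Equiv.Perm (Fin 3)) (i : Fin 3) (h : Fin 3 → ℝ) :
    extend (σ i) h ∘ σ = extend i (h ∘ σ) := by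
  funext j
  simp only [extend, Function.comp_apply, σ.injective.eq_iff, Equiv.sum_comp σ h]

theorem extend_le {h : Fin 3 → ℝ} {b : ℝ} (hb : ∀ j, h j ≤ b) (i j : Fin 3) : extend i h j ≤ b := by
  rw [extend]
  split_ifs
  · exact hb i
  · rw [Fin.sum_univ_three]
    linarith [hb i, hb j, hb 0, hb 1, hb 2]

theorem le_extend {h : Fin 3 → ℝ} {b : ℝ} (hb : ∀ j, b ≤ h j) (i j : Fin 3) : b ≤ extend i h j := by
  rw [extend]
  split_ifs
  · exact hb i
  · rw [Fin.sum_univ_three]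
    linarith [hb i, hb j, hb 0, hb 1, hb 2]

/-- This contraction of the oscillation makes the corner values along an address converge to a
common limit, uniformly in the address. -/
theorem abs_extend_sub_le {h : Fin 3 → ℝ} {d : ℝ} (hd : ∀ j k, |h j - h k| ≤ d) (i j k : Fin 3) :
    |extend i h j - extend i h k| ≤ 3 / 5 * d := by
  have hd' : ∀ j k, h j - h k ≤ d := fun j k => (le_abs_self _).trans (hd j k)
  have h01 := hd' 0 1
  have h02 := hd' 0 2
  have h12 := hd' 1 2
  have h10 := hd' 1 0
  have h20 := hd' 2 0
  have h21 := hd' 2 1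
  rw [abs_le]
  fin_cases i <;> fin_cases j <;> fin_cases k <;> simp [extend, Fin.sum_univ_three] <;>
    first
    | linarith
    | (constructor <;> linarith)

theorem extend_surjective (i : Fin 3) : Function.Surjective (extend i) := by
  intro t
  -- Adding the two equations for $j\ne i$ yields the total of the unknown triple; the witness is
  -- each equation solved with that total inserted.
  refine ⟨fun j => if j = i then t i else
    (15 * t j - 5 * ∑ k, t k + 3 * t i) / 3, ?_⟩
  funext j
  fin_cases i <;> fin_cases j <;> simp [extend, Fin.sum_univ_three] <;> ring

theorem extendWord_surjective (w : List (Fin 3)) : Function.Surjective (extendWord w) := by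
  induction w with
  | nil => exact fun t => ⟨t, rfl⟩
  | cons i w ih => exact ih.comp (extend_surjective i)

theorem extendWord_append (u w : List (Fin 3)) (h : Fin 3 → ℝ) :
    extendWord (u ++ w) h = extendWord w (extendWord u h) := by
  induction u generalizing h with
  | nil => rfl
  | cons i u ih => exact ih (extend i h)

theorem extendWord_replicate_self (n : ℕ) (i : Fin 3) (h : Fin 3 → ℝ) :
    extendWord (List.replicate n i) h i = h i := by
  induction n generalizing h with
  | zero => rfl
  | succ n ih => rw [List.replicate_succ, extendWord, ih, extend_self]

/-- The difference $\sum_j h_j-3h_i$ is the flux at corner $i$; passing to the subcell at that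
corner multiplies it by 3/5. -/
theorem sum_extendWord_replicate (n : ℕ) (i : Fin 3) (h : Fin 3 → ℝ) :
    ∑ j, extendWord (List.replicate n i) h j = 3 * h i + (3 / 5) ^ n * (∑ j, h j - 3 * h i) := by
  induction n generalizing h with
  | zero => simp [extendWord]
  | succ n ih =>
    rw [List.replicate_succ, extendWord, ih, extend_self, sum_extend]
    ring

theorem extendWord_corner (u : List (Fin 3)) (a i : Fin 3) (n : ℕ) (h : Fin 3 → ℝ) :
    extendWord (u ++ a :: List.replicate n i) h i = extend a (extendWord u h) i := by
  rw [extendWord_append, extendWord, extendWord_replicate_self]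

/-- The mean value property of harmonic functions at a common corner of two cells. -/
theorem sum_extendWord_neighbor (u : List (Fin 3)) {a i : Fin 3} (hai : a ≠ i) (n : ℕ)
    (h : Fin 3 → ℝ) :
    ∑ j, extendWord (u ++ a :: List.replicate n i) h j +
      ∑ j, extendWord (u ++ i :: List.replicate n a) h j =
      6 * extendWord (u ++ a :: List.replicate n i) h i := by
  -- Both fluxes at the common corner carry the same factor $(3/5)^n$, and they are already opposite
  -- for the larger cells $C_{ua}$ and $C_{ui}$.
  rw [extendWord_corner, extendWord_append, extendWord_append, extendWord, extendWord,
    sum_extendWord_replicate, sum_extendWord_replicate, sum_extend, sum_extend,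
    extend_of_ne hai, extend_of_ne hai.symm]
  ring

theorem stage_cons (h : Fin 3 → ℝ) (i : Fin 3) (ω : ℕ → Fin 3) (n : ℕ) :
    stage h (cons i ω) (n + 1) = stage (extend i h) ω n := by
  induction n with
  | zero => rfl
  | succ n ih => rw [stage, ih]; rfl

theorem stage_add (h k : Fin 3 → ℝ) (ω : ℕ → Fin 3) (n : ℕ) :
    stage (h + k) ω n = stage h ω n + stage k ω n := by
  induction n with
  | zero => rfl
  | succ n ih => rw [stage, ih, extend_add]; rfl

theorem stage_smul (c : ℝ) (h : Fin 3 → ℝ) (ω : ℕ → Fin 3) (n : ℕ) :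
    stage (c • h) ω n = c • stage h ω n := by
  induction n with
  | zero => rfl
  | succ n ih => rw [stage, ih, extend_smul]; rfl

theorem stage_perm (σ : Equiv.Perm (Fin 3)) (h : Fin 3 → ℝ) (ω : ℕ → Fin 3) (n : ℕ) :
    stage h (fun k => σ (ω k)) n ∘ σ = stage (h ∘ σ) ω n := by
  induction n with
  | zero => rfl
  | succ n ih => rw [stage, stage, extend_perm, ih]

theorem stage_le {h : Fin 3 → ℝ} {b : ℝ} (hb : ∀ j, h j ≤ b) (ω : ℕ → Fin 3) (n : ℕ) (j : Fin 3) :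
    stage h ω n j ≤ b := by
  induction n generalizing j with
  | zero => exact hb j
  | succ n ih => exact extend_le ih _ _

theorem le_stage {h : Fin 3 → ℝ} {b : ℝ} (hb : ∀ j, b ≤ h j) (ω : ℕ → Fin 3) (n : ℕ) (j : Fin 3) :
    b ≤ stage h ω n j := by
  induction n generalizing j with
  | zero => exact hb j
  | succ n ih => exact le_extend ih _ _

theorem abs_stage_sub_le (h : Fin 3 → ℝ) (ω : ℕ → Fin 3) (n : ℕ) (j k : Fin 3) :
    |stage h ω n j - stage h ω n k| ≤ (3 / 5) ^ n * (2 * ∑ j, |h j|) := by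
  induction n generalizing j k with
  | zero =>
    have h1 : ∀ j, |h j| ≤ ∑ j, |h j| := fun j =>
      Finset.single_le_sum (f := fun j => |h j|) (fun _ _ => abs_nonneg _) (Finset.mem_univ j)
    simp only [stage, pow_zero, one_mul]
    linarith [abs_sub (h j) (h k), h1 j, h1 k]
  | succ n ih =>
    rw [pow_succ', mul_assoc]
    exact abs_extend_sub_le ih _ _ _

theorem abs_stage_succ_sub_le (h : Fin 3 → ℝ) (ω : ℕ → Fin 3) (n : ℕ) :
    ‖stage h ω (n + 1) 0 - stage h ω n 0‖ ≤ (3 / 5) ^ n * (4 * ∑ j, |h j|) := by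
  have h1 := abs_stage_sub_le h ω (n + 1) 0 (ω n)
  have h2 := abs_stage_sub_le h ω n (ω n) 0
  have h3 : stage h ω (n + 1) (ω n) = stage h ω n (ω n) := extend_self _ _
  rw [h3] at h1
  have h4 := abs_sub_le (stage h ω (n + 1) 0) (stage h ω n (ω n)) (stage h ω n 0)
  have h5 : 0 ≤ ∑ j, |h j| := Finset.sum_nonneg fun _ _ => abs_nonneg _
  have h6 : (0 : ℝ) ≤ (3 / 5) ^ n := by positivity
  rw [Real.norm_eq_abs]
  rw [pow_succ] at h1
  nlinarith [mul_nonneg h6 h5]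

theorem summable_stage_bound (h : Fin 3 → ℝ) :
    Summable fun n : ℕ => (3 / 5 : ℝ) ^ n * (4 * ∑ j, |h j|) :=
  (summable_geometric_of_lt_one (by norm_num) (by norm_num)).mul_right _

theorem continuous_stage (h : Fin 3 → ℝ) (n : ℕ) : Continuous fun ω => stage h ω n := by
  induction n with
  | zero => exact continuous_const
  | succ n ih =>
    have h1 : Continuous fun p : Fin 3 × (Fin 3 → ℝ) => extend p.1 p.2 := by
      rw [continuous_prod_of_discrete_left]
      intro i
      refine continuous_pi fun j => ?_
      simp only [extend]
      split_ifs <;> fun_prop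
    exact h1.comp ((continuous_apply n).prodMk ih)

theorem continuous_harmonicAddr (h : Fin 3 → ℝ) : Continuous (harmonicAddr h) := by
  refine continuous_const.add
    (continuous_tsum (fun n => ?_) (summable_stage_bound h) fun n ω => abs_stage_succ_sub_le h ω n)
  exact ((continuous_apply 0).comp (continuous_stage h (n + 1))).sub
    ((continuous_apply 0).comp (continuous_stage h n))

theorem tendsto_stage (h : Fin 3 → ℝ) (ω : ℕ → Fin 3) (j : Fin 3) :
    Filter.Tendsto (fun n => stage h ω n j) Filter.atTop (nhds (harmonicAddr h ω)) := by
  have hs : Summable fun n => stage h ω (n + 1) 0 - stage h ω n 0 :=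
    Summable.of_norm_bounded (summable_stage_bound h) (abs_stage_succ_sub_le h ω)
  have h0 : Filter.Tendsto (fun n => stage h ω n 0) Filter.atTop (nhds (harmonicAddr h ω)) := by
    have := hs.hasSum.tendsto_sum_nat.const_add (h 0)
    have e : ∀ n, h 0 + (stage h ω n 0 - stage h ω 0 0) = stage h ω n 0 := fun n =>
      add_sub_cancel (h 0) _
    simp only [Finset.sum_range_sub (fun n => stage h ω n 0), e] at this
    exact this
  have h1 : Filter.Tendsto (fun n => stage h ω n j - stage h ω n 0) Filter.atTop (nhds 0) := by
    refine squeeze_zero_norm (fun n => abs_stage_sub_le h ω n j 0) ?_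
    have := (tendsto_pow_atTop_nhds_zero_of_lt_one (r := (3 / 5 : ℝ)) (by norm_num)
      (by norm_num)).mul_const (2 * ∑ j, |h j|)
    simpa using this
  simpa using h1.add h0

theorem harmonicAddr_cons (h : Fin 3 → ℝ) (i : Fin 3) (ω : ℕ → Fin 3) :
    harmonicAddr h (cons i ω) = harmonicAddr (extend i h) ω := by
  refine tendsto_nhds_unique ((tendsto_stage h (cons i ω) 0).comp (Filter.tendsto_add_atTop_nat 1)) ?_
  simp only [Function.comp_def, stage_cons]
  exact tendsto_stage _ ω 0

theorem harmonicAddr_const (h : Fin 3 → ℝ) (i : Fin 3) : harmonicAddr h (fun _ => i) = h i := by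
  have h1 : ∀ n, stage h (fun _ => i) n i = h i := by
    intro n
    induction n with
    | zero => rfl
    | succ n ih => rw [stage, extend_self, ih]
  have h2 := tendsto_stage h (fun _ => i) i
  simp only [h1] at h2
  exact tendsto_nhds_unique h2 tendsto_const_nhds

theorem harmonicAddr_add (h k : Fin 3 → ℝ) (ω : ℕ → Fin 3) :
    harmonicAddr (h + k) ω = harmonicAddr h ω + harmonicAddr k ω := by
  refine tendsto_nhds_unique (tendsto_stage (h + k) ω 0) ?_
  simp only [stage_add, Pi.add_apply]
  exact (tendsto_stage h ω 0).add (tendsto_stage k ω 0)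

theorem harmonicAddr_smul (c : ℝ) (h : Fin 3 → ℝ) (ω : ℕ → Fin 3) :
    harmonicAddr (c • h) ω = c * harmonicAddr h ω := by
  refine tendsto_nhds_unique (tendsto_stage (c • h) ω 0) ?_
  simp only [stage_smul, Pi.smul_apply, smul_eq_mul]
  exact (tendsto_stage h ω 0).const_mul c

theorem harmonicAddr_perm (σ : Equiv.Perm (Fin 3)) (h : Fin 3 → ℝ) (ω : ℕ → Fin 3) :
    harmonicAddr h (fun k => σ (ω k)) = harmonicAddr (h ∘ σ) ω := by
  refine tendsto_nhds_unique (tendsto_stage h _ (σ 0)) ?_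
  have h1 : ∀ n, stage h (fun k => σ (ω k)) n (σ 0) = stage (h ∘ σ) ω n 0 := fun n =>
    congrFun (stage_perm σ h ω n) 0
  simp only [h1]
  exact tendsto_stage _ ω 0

theorem harmonicAddr_le {h : Fin 3 → ℝ} {b : ℝ} (hb : ∀ j, h j ≤ b) (ω : ℕ → Fin 3) :
    harmonicAddr h ω ≤ b :=
  le_of_tendsto' (tendsto_stage h ω 0) fun n => stage_le hb ω n 0

theorem le_harmonicAddr {h : Fin 3 → ℝ} {b : ℝ} (hb : ∀ j, b ≤ h j) (ω : ℕ → Fin 3) :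
    b ≤ harmonicAddr h ω :=
  ge_of_tendsto' (tendsto_stage h ω 0) fun n => le_stage hb ω n 0

/-! ### Harmonic functions on the gasket -/

/-- Prepend a word to an address. -/
def prepend (w : List (Fin 3)) (ω : ℕ → Fin 3) : ℕ → Fin 3 := w.foldr cons ω

theorem addr_prepend (q : Fin 3 → Plane) (w : List (Fin 3)) (ω : ℕ → Fin 3) :
    addr q (prepend w ω) = Fw q w (addr q ω) := by
  induction w with
  | nil => rfl
  | cons i w ih => exact (addr_cons q i _).trans (congrArg (F q i) ih)

theorem harmonicAddr_prepend (h : Fin 3 → ℝ) (w : List (Fin 3)) (ω : ℕ → Fin 3) :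
    harmonicAddr h (prepend w ω) = harmonicAddr (extendWord w h) ω := by
  induction w generalizing h with
  | nil => rfl
  | cons i w ih => exact (harmonicAddr_cons h i _).trans (ih (extend i h))

theorem eq_const_of_addr_eq {q : Fin 3 → Plane} (hq : IsEquilateral q) {ω : ℕ → Fin 3} {i : Fin 3}
    (h : addr q ω = q i) : ω = fun _ => i := by
  funext n
  induction n generalizing ω with
  | zero =>
    rw [addr_eq] at h
    exact (eq_of_F_eq_vertex hq ⟨_, rfl⟩ h).1
  | succ n ih =>
    rw [addr_eq] at h
    exact ih (eq_of_F_eq_vertex hq ⟨_, rfl⟩ h).2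

/-- Two addresses of one point split at letters $a\ne b$ and continue with constant tails $b$ and
$a$, where `extend_comm` equates the values. This makes `harmonicExt` independent of the chosen
address. -/
theorem harmonicAddr_congr {q : Fin 3 → Plane} (hq : IsEquilateral q) (h : Fin 3 → ℝ)
    {ω ω' : ℕ → Fin 3} (hω : addr q ω = addr q ω') : harmonicAddr h ω = harmonicAddr h ω' := by
  by_cases heq : ω = ω'
  · rw [heq]
  obtain ⟨n, hn⟩ := Function.ne_iff.1 heq
  clear heq
  induction n generalizing ω ω' h with
  | zero =>
    rw [addr_eq, addr_eq q ω'] at hω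
    obtain ⟨h1, h2⟩ := eq_vertex_of_F_eq_F hq ⟨_, rfl⟩ ⟨_, rfl⟩ hn hω
    rw [← cons_tail ω, ← cons_tail ω', harmonicAddr_cons, harmonicAddr_cons,
      eq_const_of_addr_eq hq h1, eq_const_of_addr_eq hq h2, harmonicAddr_const, harmonicAddr_const,
      extend_comm]
  | succ n ih =>
    rw [addr_eq, addr_eq q ω'] at hω
    rw [← cons_tail ω, ← cons_tail ω', harmonicAddr_cons, harmonicAddr_cons]
    by_cases h0 : ω 0 = ω' 0
    · rw [h0] at hω ⊢
      exact ih _ (F_injective q _ hω) hn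
    · obtain ⟨h1, h2⟩ := eq_vertex_of_F_eq_F hq ⟨_, rfl⟩ ⟨_, rfl⟩ h0 hω
      rw [eq_const_of_addr_eq hq h1, eq_const_of_addr_eq hq h2, harmonicAddr_const,
        harmonicAddr_const, extend_comm]

open Classical in
/-- The harmonic function with given values at the vertices. -/
noncomputable def harmonicExt (q : Fin 3 → Plane) (h : Fin 3 → ℝ) (x : Plane) : ℝ :=
  if hx : x ∈ SG q then harmonicAddr h hx.choose else 0

theorem harmonicExt_addr {q : Fin 3 → Plane} (hq : IsEquilateral q) (h : Fin 3 → ℝ)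
    (ω : ℕ → Fin 3) : harmonicExt q h (addr q ω) = harmonicAddr h ω := by
  have hx : addr q ω ∈ SG q := ⟨ω, rfl⟩
  rw [harmonicExt, dif_pos hx]
  exact harmonicAddr_congr hq h hx.choose_spec

theorem harmonicExt_corner {q : Fin 3 → Plane} (hq : IsEquilateral q) (h : Fin 3 → ℝ)
    (w : List (Fin 3)) (i : Fin 3) : harmonicExt q h (corner q w i) = extendWord w h i := by
  rw [corner, ← addr_const q i, ← addr_prepend, harmonicExt_addr hq, harmonicAddr_prepend,
    harmonicAddr_const]

theorem continuousOn_harmonicExt {q : Fin 3 → Plane} (hq : IsEquilateral q) (h : Fin 3 → ℝ) :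
    ContinuousOn (harmonicExt q h) (SG q) := by
  rw [continuousOn_iff_continuous_domRestrict]
  have hc : Continuous (rangeFactorization (addr q)) := (addr_continuous q).rangeFactorization
  -- A continuous surjection from a compact space onto a Hausdorff space is a quotient map, so
  -- continuity can be tested on addresses.
  have hquot : Topology.IsQuotientMap (rangeFactorization (addr q)) :=
    Topology.IsQuotientMap.of_surjective_continuous rangeFactorization_surjective hc
  refine hquot.continuous_iff.2 ?_
  have : (SG q).domRestrict (harmonicExt q h) ∘ rangeFactorization (addr q) = harmonicAddr h :=
    funext fun ω => harmonicExt_addr hq h ω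
  exact this ▸ continuous_harmonicAddr h

/-- The neighbors in the graph of level `m` of a common corner of two cells of level `m`. -/
theorem setOf_adj_corner {q : Fin 3 → Plane} (hq : IsEquilateral q) {a i : Fin 3} (hai : a ≠ i)
    (u : List (Fin 3)) (n : ℕ) :
    {y | Adj q (u.length + n + 1) (corner q (u ++ a :: List.replicate n i) i) y} =
      corner q (u ++ a :: List.replicate n i) '' {i}ᶜ ∪
        corner q (u ++ i :: List.replicate n a) '' {a}ᶜ := by
  ext y
  constructor
  · rintro ⟨hne, w, hw, ⟨k, hk⟩, j, rfl⟩
    rcases eq_of_Fw_eq_corner hq (vertex_mem_SG q k) hai hw hk.symm with ⟨rfl, h2⟩ | ⟨rfl, h2⟩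
    · left
      refine ⟨j, fun h => hne ?_, rfl⟩
      rw [mem_singleton_iff.1 h]
    · right
      refine ⟨j, fun h => hne ?_, rfl⟩
      rw [mem_singleton_iff.1 h, corner_eq_corner_neighbor]
  · rintro (⟨j, hj, rfl⟩ | ⟨j, hj, rfl⟩)
    · exact ⟨fun h => hj (corner_injective hq _ h).symm, _, by simp [add_assoc], ⟨i, rfl⟩, j, rfl⟩
    · rw [corner_eq_corner_neighbor]
      exact ⟨fun h => hj (corner_injective hq _ h).symm, _, by simp [add_assoc], ⟨a, rfl⟩, j, rfl⟩

theorem finsum_corner_compl {q : Fin 3 → Plane} (hq : IsEquilateral q) (h : Plane → ℝ)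
    (w : List (Fin 3)) (i : Fin 3) :
    ∑ᶠ y ∈ corner q w '' {i}ᶜ, h y = ∑ j, h (corner q w j) - h (corner q w i) := by
  rw [finsum_mem_image (corner_injective hq w).injOn,
    ← Finset.add_sum_erase _ _ (Finset.mem_univ i), add_sub_cancel_left]
  rw [← finsum_mem_finset_eq_sum]
  simp

theorem finsum_adj_corner {q : Fin 3 → Plane} (hq : IsEquilateral q) (h : Plane → ℝ) {a i : Fin 3}
    (hai : a ≠ i) (u : List (Fin 3)) (n : ℕ) :
    ∑ᶠ y ∈ {y | Adj q (u.length + n + 1) (corner q (u ++ a :: List.replicate n i) i) y}, h y =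
      ∑ j, h (corner q (u ++ a :: List.replicate n i) j) +
        ∑ j, h (corner q (u ++ i :: List.replicate n a) j) -
        2 * h (corner q (u ++ a :: List.replicate n i) i) := by
  rw [setOf_adj_corner hq hai, finsum_mem_union, finsum_corner_compl hq, finsum_corner_compl hq,
    corner_eq_corner_neighbor q u a i n]
  · ring
  · rw [Set.disjoint_left]
    rintro _ ⟨j, hj, rfl⟩ ⟨k, -, hk⟩
    have h1 := ((isNeighbor_iff hq hai n u _).2 rfl).2.subset
      ⟨hk ▸ corner_mem_cell q _ k, corner_mem_cell q _ j⟩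
    exact hj (corner_injective hq _ h1)
  · exact (toFinite _).image _
  · exact (toFinite _).image _

theorem isHarmonic_harmonicExt {q : Fin 3 → Plane} (hq : IsEquilateral q) (h : Fin 3 → ℝ) :
    IsHarmonic q (harmonicExt q h) := by
  refine ⟨continuousOn_harmonicExt hq h, ?_⟩
  rintro m x ⟨⟨w, rfl, i, rfl⟩, hx⟩
  rcases exists_word_decomposition w i with hw | ⟨u, a, n, hai, rfl⟩
  · refine absurd ((mem_V_zero q).2 ⟨i, ?_⟩) hx
    rw [corner, hw, Fw_replicate]
  · have hl : (u ++ a :: List.replicate n i).length = u.length + n + 1 := by simp [add_assoc]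
    rw [hl, finsum_adj_corner hq _ hai]
    simp only [harmonicExt_corner hq]
    rw [sum_extendWord_neighbor u hai n h]
    ring

/-- The mean value equations at the three edge midpoints of $C_w$ form a nonsingular linear system,
and its solution is the 1/5-2/5 rule. -/
theorem IsHarmonic.corner_append {q : Fin 3 → Plane} (hq : IsEquilateral q) {h : Plane → ℝ}
    (hh : IsHarmonic q h) (w : List (Fin 3)) (i j : Fin 3) :
    h (corner q (w ++ [i]) j) = extend i (fun k => h (corner q w k)) j := by
  have hself : ∀ i, h (corner q (w ++ [i]) i) = h (corner q w i) := fun i => by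
    rw [corner, Fw_append]
    exact congrArg (fun x => h (Fw q w x)) (F_self q i)
  have hcomm : ∀ i j, h (corner q (w ++ [i]) j) = h (corner q (w ++ [j]) i) := fun i j => by
    rw [corner, corner, Fw_append, Fw_append]
    exact congrArg (fun x => h (Fw q w x)) (F_comm q i j)
  have key : ∀ i j, i ≠ j → 6 * h (corner q (w ++ [i]) j) =
      ∑ k, h (corner q (w ++ [i]) k) + ∑ k, h (corner q (w ++ [j]) k) := by
    intro i j hij
    have h1 := hh.2 (w.length + 0 + 1) (corner q (w ++ i :: List.replicate 0 j) j)
      ⟨⟨_, by simp, _, rfl⟩, fun h0 => ?_⟩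
    · rw [finsum_adj_corner hq h hij w 0] at h1
      simp only [List.replicate_zero] at h1
      linarith
    · obtain ⟨l, hl⟩ := (mem_V_zero q).1 h0
      obtain ⟨h2, h3⟩ := eq_of_Fw_eq_vertex hq (vertex_mem_SG q j) hl
      have h4 : i ∈ w ++ i :: List.replicate 0 j := by simp
      rw [h2] at h4
      exact hij ((List.eq_of_mem_replicate h4).trans (vertex_injective hq h3).symm)
  have k01 := key 0 1 (by decide)
  have k02 := key 0 2 (by decide)
  have k12 := key 1 2 (by decide)
  rw [Fin.sum_univ_three, Fin.sum_univ_three] at k01 k02 k12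
  rw [hcomm 1 0, hself 0, hself 1] at k01
  rw [hcomm 2 0, hcomm 2 1, hself 0, hself 2] at k02
  rw [hcomm 1 0, hcomm 2 0, hcomm 2 1, hself 1, hself 2] at k12
  by_cases hij : j = i
  · rw [hij, hself, extend_self]
  · rw [extend_of_ne hij, Fin.sum_univ_three]
    fin_cases i <;> fin_cases j <;> simp at hij ⊢ <;>
      first
      | linarith
      | (rw [hcomm]; linarith)

theorem corner_map_range (q : Fin 3 → Plane) (ω : ℕ → Fin 3) (n : ℕ) :
    corner q ((List.range n).map ω) 0 = addr q (fun k => if k < n then ω k else 0) := by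
  induction n generalizing ω with
  | zero => simpa [corner, Fw] using (addr_const q 0).symm
  | succ n ih =>
    rw [addr_eq, List.range_succ_eq_map, List.map_cons, corner, Fw_cons, List.map_map]
    have := ih (fun k => ω (k + 1))
    rw [corner] at this
    simpa [Function.comp_def] using congrArg (F q (ω 0)) this

theorem IsHarmonic.eq_harmonicAddr {q : Fin 3 → Plane} (hq : IsEquilateral q) {h : Plane → ℝ}
    (hh : IsHarmonic q h) (ω : ℕ → Fin 3) :
    h (addr q ω) = harmonicAddr (fun i => h (q i)) ω := by
  have h1 : ∀ n j, h (corner q ((List.range n).map ω) j) = stage (fun i => h (q i)) ω n j := by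
    intro n
    induction n with
    | zero => exact fun j => rfl
    | succ n ih =>
      intro j
      rw [List.range_succ, List.map_append, List.map_singleton, hh.corner_append hq, stage]
      exact congrFun (congrArg _ (funext ih)) j
  -- The truncated addresses represent corners, where the values are already known; continuity of
  -- $h$ carries the identity to the limit.
  have h2 : Filter.Tendsto (fun n k => if k < n then ω k else 0) Filter.atTop (nhds ω) := by
    rw [tendsto_pi_nhds]
    intro k
    refine tendsto_const_nhds.congr' ?_
    filter_upwards [Filter.eventually_gt_atTop k] with n hn
    rw [if_pos hn]
  have hc : Continuous fun ω => h (addr q ω) :=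
    hh.1.comp_continuous (addr_continuous q) fun ω => ⟨ω, rfl⟩
  have h3 := (hc.tendsto ω).comp h2
  simp only [Function.comp_def, ← corner_map_range, h1] at h3
  exact tendsto_nhds_unique h3 (tendsto_stage _ ω 0)

theorem IsHarmonic.Fw_addr {q : Fin 3 → Plane} (hq : IsEquilateral q) {h : Plane → ℝ}
    (hh : IsHarmonic q h) (w : List (Fin 3)) (ω : ℕ → Fin 3) :
    h (Fw q w (addr q ω)) = harmonicAddr (extendWord w fun i => h (q i)) ω := by
  rw [← addr_prepend, hh.eq_harmonicAddr hq, harmonicAddr_prepend]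

theorem IsHarmonic.corner {q : Fin 3 → Plane} (hq : IsEquilateral q) {h : Plane → ℝ}
    (hh : IsHarmonic q h) (w : List (Fin 3)) (i : Fin 3) :
    h (corner q w i) = extendWord w (fun i => h (q i)) i := by
  rw [SGasket.corner, ← addr_const q i, hh.Fw_addr hq, harmonicAddr_const]

/-! ### Self-similarity of the measures -/

/-- The uniform Bernoulli measure on addresses. -/
noncomputable def addrMeasure : Measure (ℕ → Fin 3) :=
  Measure.infinitePi fun _ : ℕ => (PMF.uniformOfFintype (Fin 3)).toMeasure

instance : IsProbabilityMeasure addrMeasure := by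
  unfold addrMeasure
  infer_instance

theorem mu_eq_map (q : Fin 3 → Plane) : mu q = addrMeasure.map (addr q) := rfl

theorem measurable_cons (i : Fin 3) : Measurable (cons i) := (continuous_cons i).measurable

theorem uniform_apply (t : Set (Fin 3)) :
    (PMF.uniformOfFintype (Fin 3)).toMeasure t = 3⁻¹ * ∑ i, t.indicator (fun _ => 1) i := by
  rw [PMF.toMeasure_apply_fintype, Finset.mul_sum]
  refine Finset.sum_congr rfl fun i _ => ?_
  by_cases h : i ∈ t <;> simp [h]

theorem addrMeasure_pi_range (N : ℕ) (t : ℕ → Set (Fin 3)) :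
    addrMeasure (Set.pi (Finset.range N) t) =
      ∏ k ∈ Finset.range N, (PMF.uniformOfFintype (Fin 3)).toMeasure (t k) :=
  Measure.infinitePi_pi _ fun _ _ => MeasurableSet.of_discrete

theorem cons_preimage_pi_range (i : Fin 3) (N : ℕ) (t : ℕ → Set (Fin 3)) :
    cons i ⁻¹' Set.pi (Finset.range (N + 1)) t =
      {ω | i ∈ t 0 ∧ ω ∈ Set.pi (Finset.range N) fun k => t (k + 1)} := by
  ext ω
  simp only [mem_preimage, Set.mem_pi, Finset.coe_range, mem_Iio, mem_ofPred_eq]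
  constructor
  · exact fun h => ⟨h 0 (Nat.succ_pos N), fun k hk => h (k + 1) (Nat.succ_lt_succ hk)⟩
  · rintro ⟨h0, h1⟩ k hk
    cases k with
    | zero => exact h0
    | succ k => exact h1 k (Nat.lt_of_succ_lt_succ hk)

theorem addrMeasure_eq : addrMeasure = (3⁻¹ : ENNReal) • ∑ i, addrMeasure.map (cons i) := by
  symm
  refine Measure.eq_infinitePi _ fun s t ht => ?_
  obtain ⟨N, hN⟩ : ∃ N, s ⊆ Finset.range (N + 1) := by
    obtain ⟨N, hN⟩ := s.exists_nat_subset_range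
    exact ⟨N, hN.trans (Finset.range_mono N.le_succ)⟩
  -- Trivial factors enlarge the cylinder's index set to an initial segment, so that the first
  -- letter can be split off.
  set t' : ℕ → Set (Fin 3) := fun k => if k ∈ s then t k else univ with ht'
  have h1 : Set.pi (s : Set ℕ) t = Set.pi (Finset.range (N + 1)) t' := by
    ext ω
    simp only [Set.mem_pi, ht']
    constructor
    · intro h k _
      split_ifs with hk
      · exact h k hk
      · trivial
    · intro h k hk
      have := h k (hN hk)
      rwa [if_pos (Finset.mem_coe.1 hk)] at this
  have h2 : ∏ k ∈ s, (PMF.uniformOfFintype (Fin 3)).toMeasure (t k) =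
      ∏ k ∈ Finset.range (N + 1), (PMF.uniformOfFintype (Fin 3)).toMeasure (t' k) := by
    rw [← Finset.prod_subset hN]
    · refine Finset.prod_congr rfl fun k hk => ?_
      simp only [ht', if_pos hk]
    · intro k _ hk
      simp only [ht', if_neg hk, measure_univ]
  have hm : MeasurableSet (Set.pi (Finset.range (N + 1) : Set ℕ) t') :=
    MeasurableSet.pi (Finset.countable_toSet _) fun _ _ => MeasurableSet.of_discrete
  rw [h1, h2, Finset.prod_range_succ', Measure.smul_apply, Measure.finsetSum_apply, uniform_apply,
    smul_eq_mul, mul_comm (∏ k ∈ _, _), mul_assoc, Finset.sum_mul]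
  congr 1
  refine Finset.sum_congr rfl fun i _ => ?_
  rw [Measure.map_apply (measurable_cons i) hm, cons_preimage_pi_range]
  by_cases hi : i ∈ t' 0
  · simp only [hi, true_and, indicator_of_mem, one_mul]
    exact addrMeasure_pi_range N _
  · simp [hi]

theorem addrMeasure_apply {s : Set (ℕ → Fin 3)} (hs : MeasurableSet s) :
    addrMeasure s = 3⁻¹ * ∑ i, addrMeasure (cons i ⁻¹' s) := by
  conv_lhs => rw [addrMeasure_eq]
  rw [Measure.smul_apply, Measure.finsetSum_apply, smul_eq_mul]
  congr 1
  exact Finset.sum_congr rfl fun i _ => Measure.map_apply (measurable_cons i) hs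

theorem integrable_of_continuous {f : (ℕ → Fin 3) → ℝ} (hf : Continuous f) (P : Measure (ℕ → Fin 3))
    [IsFiniteMeasure P] : Integrable f P := by
  obtain ⟨C, hC⟩ := isCompact_univ.exists_bound_of_continuousOn hf.continuousOn
  exact Integrable.of_bound hf.aestronglyMeasurable C
    (Filter.Eventually.of_forall fun x => hC x (mem_univ x))

theorem setIntegral_addrMeasure {f : (ℕ → Fin 3) → ℝ} (hf : Continuous f) {s : Set (ℕ → Fin 3)}
    (hs : MeasurableSet s) :
    ∫ ω in s, f ω ∂addrMeasure = 1 / 3 * ∑ i, ∫ ω in cons i ⁻¹' s, f (cons i ω) ∂addrMeasure := by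
  conv_lhs => rw [addrMeasure_eq]
  have hfin : ∀ i, IsFiniteMeasure (addrMeasure.map (cons i)) := fun i => inferInstance
  rw [← integral_indicator hs, integral_smul_measure,
    integral_finsetSum_measure fun i _ => (integrable_of_continuous hf _).indicator hs]
  simp only [ENNReal.toReal_inv, ENNReal.toReal_ofNat, smul_eq_mul, one_div]
  congr 1
  exact Finset.sum_congr rfl fun i _ => (integral_indicator hs).trans <|
    setIntegral_map hs hf.aestronglyMeasurable (measurable_cons i).aemeasurable

/-! ### The measure on the gasket and its restriction to cells -/

theorem measurableSet_SG (q : Fin 3 → Plane) : MeasurableSet (SG q) :=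
  (SG_isCompact q).isClosed.measurableSet

theorem mu_compl_SG (q : Fin 3 → Plane) : mu q (SG q)ᶜ = 0 := by
  rw [mu_eq_map, Measure.map_apply (addr_continuous q).measurable (measurableSet_SG q).compl]
  have : addr q ⁻¹' (SG q)ᶜ = ∅ := by
    ext ω
    simp [SG]
  rw [this, measure_empty]

theorem mu_restrict_SG (q : Fin 3 → Plane) : (mu q).restrict (SG q) = mu q :=
  Measure.restrict_eq_self_of_ae_mem (mu_compl_SG q)

theorem mu_apply (q : Fin 3 → Plane) {s : Set Plane} (hs : MeasurableSet s) :
    mu q s = 3⁻¹ * ∑ i, mu q (F q i ⁻¹' s) := by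
  have ha := (addr_continuous q).measurable
  rw [mu_eq_map, Measure.map_apply ha hs, addrMeasure_apply (ha hs)]
  congr 1
  refine Finset.sum_congr rfl fun i _ => ?_
  rw [Measure.map_apply ha ((continuous_F q i).measurable hs)]
  congr 1
  ext ω
  simp only [mem_preimage, addr_cons]

/-- Only $F_i$ reaches $q_i$ from the gasket, so self-similarity makes this mass equal to a third of
itself. -/
theorem mu_vertex {q : Fin 3 → Plane} (hq : IsEquilateral q) (i : Fin 3) : mu q {q i} = 0 := by
  have h := mu_apply q (measurableSet_singleton (q i))
  rw [Finset.sum_eq_single i] at h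
  · have h1 : F q i ⁻¹' {q i} = {q i} := by
      ext x
      rw [mem_preimage, mem_singleton_iff, mem_singleton_iff]
      nth_rewrite 1 [← F_self q i]
      exact (F_injective q i).eq_iff
    rw [h1] at h
    have h2 := congrArg ENNReal.toReal h
    rw [ENNReal.toReal_mul, ENNReal.toReal_inv, ENNReal.toReal_ofNat] at h2
    have h3 : (mu q {q i}).toReal = 0 := by linarith
    exact ((ENNReal.toReal_eq_zero_iff _).1 h3).resolve_right (measure_ne_top _ _)
  · intro j _ hji
    refine measure_mono_null (t := (SG q)ᶜ) (fun x hx hxs => ?_) (mu_compl_SG q)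
    exact hji (eq_of_F_eq_vertex hq hxs hx).1
  · simp

theorem mu_restrict_F_image {q : Fin 3 → Plane} (hq : IsEquilateral q) (i : Fin 3) :
    (mu q).restrict (F q i '' SG q) = (3⁻¹ : ENNReal) • (mu q).map (F q i) := by
  have hi : MeasurableSet (F q i '' SG q) :=
    ((SG_isCompact q).image (continuous_F q i)).isClosed.measurableSet
  ext s hs
  rw [Measure.restrict_apply hs, mu_apply q (hs.inter hi), Measure.smul_apply, smul_eq_mul,
    Measure.map_apply (continuous_F q i).measurable hs, Finset.sum_eq_single i]
  · rw [preimage_inter, preimage_image_eq _ (F_injective q i),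
      ← Measure.restrict_apply ((continuous_F q i).measurable hs), mu_restrict_SG]
  · intro j _ hji
    have h0 : mu q ({q i} ∪ (SG q)ᶜ) = 0 :=
      measure_union_null (mu_vertex hq i) (mu_compl_SG q)
    refine measure_mono_null ?_ h0
    rintro x ⟨-, y, hy, hxy⟩
    by_cases hx : x ∈ SG q
    · exact Or.inl (eq_vertex_of_F_eq_F hq hx hy hji hxy.symm).1
    · exact Or.inr hx
  · simp

theorem measurableEmbedding_Fw (q : Fin 3 → Plane) (w : List (Fin 3)) :
    MeasurableEmbedding (Fw q w) := (continuous_Fw q w).measurableEmbedding (Fw_injective q w)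

theorem mu_restrict_cell {q : Fin 3 → Plane} (hq : IsEquilateral q) (w : List (Fin 3)) :
    (mu q).restrict (cell q w) = (3⁻¹ : ENNReal) ^ w.length • (mu q).map (Fw q w) := by
  induction w with
  | nil =>
    have h1 : cell q [] = SG q := by simp [cell, Fw]
    rw [h1, mu_restrict_SG, List.length_nil, pow_zero, one_smul]
    exact Measure.map_id.symm
  | cons i w ih =>
    have hc : cell q (i :: w) = F q i '' cell q w := by
      rw [cell, cell, ← image_comp]
      rfl
    have hF : MeasurableEmbedding (F q i) :=
      (continuous_F q i).measurableEmbedding (F_injective q i)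
    have hm : MeasurableSet (cell q (i :: w)) := (isCompact_cell q _).isClosed.measurableSet
    have hsub : cell q (i :: w) ⊆ F q i '' SG q := by
      rw [hc]
      exact image_mono (cell_subset_SG q w)
    rw [← inter_eq_left.2 hsub, ← Measure.restrict_restrict hm, mu_restrict_F_image hq,
      Measure.restrict_smul, hF.restrict_map, hc, preimage_image_eq _ (F_injective q i), ih,
      Measure.map_smul, Measure.map_map (continuous_F q i).measurable
        (continuous_Fw q w).measurable, smul_smul, List.length_cons, pow_succ']
    rfl

theorem mu_restrict_Fw_image {q : Fin 3 → Plane} (hq : IsEquilateral q) (w : List (Fin 3))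
    {s : Set Plane} (hs : MeasurableSet s) (hsub : s ⊆ SG q) :
    (mu q).restrict (Fw q w '' s) =
      (3⁻¹ : ENNReal) ^ w.length • ((mu q).restrict s).map (Fw q w) := by
  have hF := measurableEmbedding_Fw q w
  have h1 : Fw q w '' s ⊆ cell q w := image_mono hsub
  rw [← inter_eq_left.2 h1, ← Measure.restrict_restrict (hF.measurableSet_image.2 hs),
    mu_restrict_cell hq, Measure.restrict_smul, hF.restrict_map,
    preimage_image_eq _ (Fw_injective q w)]

theorem setIntegral_Fw_image {q : Fin 3 → Plane} (hq : IsEquilateral q) (w : List (Fin 3))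
    {s : Set Plane} (hs : MeasurableSet s) (hsub : s ⊆ SG q) (h : Plane → ℝ) :
    ∫ x in Fw q w '' s, h x ∂mu q = (1 / 3) ^ w.length * ∫ x in s, h (Fw q w x) ∂mu q := by
  rw [mu_restrict_Fw_image hq w hs hsub, integral_smul_measure,
    (measurableEmbedding_Fw q w).integral_map]
  simp

theorem measureReal_Fw_image {q : Fin 3 → Plane} (hq : IsEquilateral q) (w : List (Fin 3))
    {s : Set Plane} (hs : MeasurableSet s) (hsub : s ⊆ SG q) :
    (mu q).real (Fw q w '' s) = (1 / 3) ^ w.length * (mu q).real s := by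
  simpa using setIntegral_Fw_image hq w hs hsub fun _ => 1

theorem mu_corner {q : Fin 3 → Plane} (hq : IsEquilateral q) (w : List (Fin 3)) (i : Fin 3) :
    mu q {corner q w i} = 0 := by
  have h := measureReal_Fw_image hq w (measurableSet_singleton (q i))
    (singleton_subset_iff.2 (vertex_mem_SG q i))
  rw [image_singleton, measureReal_def, measureReal_def, mu_vertex hq, ENNReal.toReal_zero,
    mul_zero] at h
  exact ((ENNReal.toReal_eq_zero_iff _).1 h).resolve_right (measure_ne_top _ _)

theorem mu_cell_inter_cell {q : Fin 3 → Plane} (hq : IsEquilateral q) {w v : List (Fin 3)}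
    (hl : w.length = v.length) (hwv : w ≠ v) : mu q (cell q w ∩ cell q v) = 0 := by
  refine measure_mono_null (t := ⋃ i, {corner q w i}) ?_
    (measure_iUnion_null fun i => mu_corner hq w i)
  rintro _ ⟨⟨x, hx, rfl⟩, y, hy, h⟩
  obtain ⟨i, rfl⟩ := exists_vertex_of_Fw_eq_Fw hq hx hy hl hwv h.symm
  exact mem_iUnion.2 ⟨i, rfl⟩

theorem aestronglyMeasurable_of_continuousOn {q : Fin 3 → Plane} {h : Plane → ℝ}
    (hh : ContinuousOn h (SG q)) : AEStronglyMeasurable h (mu q) := by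
  have := hh.aestronglyMeasurable (μ := mu q) (measurableSet_SG q)
  rwa [mu_restrict_SG] at this

theorem integrable_of_continuousOn {q : Fin 3 → Plane} {h : Plane → ℝ}
    (hh : ContinuousOn h (SG q)) : Integrable h (mu q) := by
  have := hh.integrableOn_compact (μ := mu q) (SG_isCompact q)
  rwa [IntegrableOn, mu_restrict_SG] at this

theorem setIntegral_mu {q : Fin 3 → Plane} {h : Plane → ℝ} (hh : ContinuousOn h (SG q))
    {s : Set Plane} (hs : MeasurableSet s) :
    ∫ x in s, h x ∂mu q = ∫ ω in addr q ⁻¹' s, h (addr q ω) ∂addrMeasure :=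
  setIntegral_map hs (aestronglyMeasurable_of_continuousOn hh)
    (addr_continuous q).measurable.aemeasurable

/-! ### Heights -/

/-- The normalized distance, along the symmetry axis through the vertex `a`, of the point with
address `ω` from the vertex `a`. -/
noncomputable def height (a : Fin 3) (ω : ℕ → Fin 3) : ℝ :=
  ∑' k : ℕ, (1 / 2 : ℝ) ^ (k + 1) * if ω k = a then 0 else 1

theorem height_term_nonneg (a : Fin 3) (ω : ℕ → Fin 3) (k : ℕ) :
    0 ≤ (1 / 2 : ℝ) ^ (k + 1) * if ω k = a then 0 else 1 := by
  split_ifs <;> positivity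

theorem height_term_le (a : Fin 3) (ω : ℕ → Fin 3) (k : ℕ) :
    ((1 / 2 : ℝ) ^ (k + 1) * if ω k = a then 0 else 1) ≤ (1 / 2 : ℝ) ^ (k + 1) :=
  mul_le_of_le_one_right (by positivity) (by split_ifs <;> norm_num)

theorem hasSum_half_pow : HasSum (fun k : ℕ => (1 / 2 : ℝ) ^ (k + 1)) 1 := by
  have := hasSum_geometric_two.mul_left (1 / 2 : ℝ)
  norm_num at this
  simpa [pow_succ'] using this

theorem summable_height (a : Fin 3) (ω : ℕ → Fin 3) :
    Summable fun k : ℕ => (1 / 2 : ℝ) ^ (k + 1) * if ω k = a then 0 else 1 :=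
  Summable.of_nonneg_of_le (height_term_nonneg a ω) (height_term_le a ω) hasSum_half_pow.summable

theorem height_nonneg (a : Fin 3) (ω : ℕ → Fin 3) : 0 ≤ height a ω :=
  tsum_nonneg (height_term_nonneg a ω)

theorem height_le_one (a : Fin 3) (ω : ℕ → Fin 3) : height a ω ≤ 1 := by
  rw [← hasSum_half_pow.tsum_eq]
  exact (summable_height a ω).tsum_le_tsum (height_term_le a ω) hasSum_half_pow.summable

theorem height_cons (a i : Fin 3) (ω : ℕ → Fin 3) :
    height a (cons i ω) = ((if i = a then 0 else 1) + height a ω) / 2 := by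
  rw [height, (summable_height a _).tsum_eq_zero_add, height, add_div, ← tsum_div_const]
  congr 1
  · change (1 / 2 : ℝ) ^ (0 + 1) * (if i = a then 0 else 1) = _
    ring
  · refine tsum_congr fun k => ?_
    change (1 / 2 : ℝ) ^ (k + 1 + 1) * (if ω k = a then 0 else 1) = _
    ring

theorem height_perm (σ : Equiv.Perm (Fin 3)) (a : Fin 3) (ω : ℕ → Fin 3) :
    height (σ a) (fun k => σ (ω k)) = height a ω := by
  simp only [height, σ.injective.eq_iff]

theorem continuous_height (a : Fin 3) : Continuous (height a) := by
  refine continuous_tsum (fun k => ?_) hasSum_half_pow.summable fun k ω => ?_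
  · exact (continuous_of_discreteTopology
      (f := fun i : Fin 3 => (1 / 2 : ℝ) ^ (k + 1) * if i = a then 0 else 1)).comp
      (continuous_apply k)
  · rw [Real.norm_of_nonneg (height_term_nonneg a ω k)]
    exact height_term_le a ω k

/-- Both sides satisfy the same recursion under the shift, which halves their difference; being
bounded, the difference vanishes. -/
theorem one_sub_bary_addr {q : Fin 3 → Plane} (hq : IsEquilateral q) (a : Fin 3) (ω : ℕ → Fin 3) :
    1 - bary q a (addr q ω) = height a ω := by
  have h1 : ∀ n : ℕ, ∀ ω, |1 - bary q a (addr q ω) - height a ω| ≤ (1 / 2 : ℝ) ^ n := by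
    intro n
    induction n with
    | zero =>
      intro ω
      have h2 := bary_nonneg hq (x := addr q ω) ⟨ω, rfl⟩ a
      have h3 := bary_le_one hq (x := addr q ω) ⟨ω, rfl⟩ a
      have h4 := height_nonneg a ω
      have h5 := height_le_one a ω
      rw [pow_zero, abs_le]
      constructor <;> linarith
    | succ n ih =>
      intro ω
      have h2 := ih fun k => ω (k + 1)
      have e : 1 - bary q a (addr q ω) - height a ω = (1 / 2) *
          (1 - bary q a (addr q fun k => ω (k + 1)) - height a fun k => ω (k + 1)) := by
        rw [← cons_tail ω, addr_cons, bary_F, bary_vertex hq, height_cons]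
        simp only [eq_comm (a := a), cons]
        split_ifs <;> ring
      rw [e, abs_mul, abs_of_pos (by norm_num), pow_succ']
      gcongr
  have h2 := ge_of_tendsto' (tendsto_pow_atTop_nhds_zero_of_lt_one (r := (1 / 2 : ℝ)) (by norm_num)
    (by norm_num)) fun n => h1 n ω
  exact sub_eq_zero.1 (abs_nonpos_iff.1 h2)

theorem measurableSet_height_le (a : Fin 3) (c : ℝ) : MeasurableSet {ω | height a ω ≤ c} :=
  (isClosed_le (continuous_height a) continuous_const).measurableSet

/-! ### Integrals of harmonic functions over the cut-off parts -/

theorem addrMeasure_map_perm (σ : Equiv.Perm (Fin 3)) :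
    addrMeasure.map (fun ω k => σ (ω k)) = addrMeasure := by
  refine Measure.eq_infinitePi _ fun s t ht => ?_
  have hm : Measurable fun (ω : ℕ → Fin 3) k => σ (ω k) := by
    refine measurable_pi_lambda _ fun k => ?_
    exact (measurable_of_countable σ).comp (measurable_pi_apply k)
  have h1 : (fun (ω : ℕ → Fin 3) k => σ (ω k)) ⁻¹' Set.pi s t = Set.pi s fun k => σ ⁻¹' t k := rfl
  rw [Measure.map_apply hm (MeasurableSet.pi (Finset.countable_toSet _) fun k _ => ht k), h1,
    addrMeasure, Measure.infinitePi_pi _ fun _ _ => MeasurableSet.of_discrete]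
  refine Finset.prod_congr rfl fun k _ => ?_
  rw [uniform_apply, uniform_apply, ← Equiv.sum_comp σ ((t k).indicator _)]
  rfl

/-- The integral of the harmonic function with corner values `h` over the part of height at most
`c` of the gasket. -/
noncomputable def cutIntegral (a : Fin 3) (c : ℝ) (h : Fin 3 → ℝ) : ℝ :=
  ∫ ω in {ω | height a ω ≤ c}, harmonicAddr h ω ∂addrMeasure

/-- The mass of the part of height at most `c` of the gasket. -/
noncomputable def mass (c : ℝ) : ℝ := addrMeasure.real {ω | height 0 ω ≤ c}

/-- The integral over the part of height at most `c` of the harmonic function that vanishes at the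
vertex and is one at the other vertices. -/
noncomputable def moment (c : ℝ) : ℝ := cutIntegral 0 c fun j => if j = 0 then 0 else 1

theorem integrable_harmonicAddr (h : Fin 3 → ℝ) (P : Measure (ℕ → Fin 3)) [IsFiniteMeasure P] :
    Integrable (harmonicAddr h) P := integrable_of_continuous (continuous_harmonicAddr h) P

theorem cutIntegral_add (a : Fin 3) (c : ℝ) (h k : Fin 3 → ℝ) :
    cutIntegral a c (h + k) = cutIntegral a c h + cutIntegral a c k := by
  simp only [cutIntegral, harmonicAddr_add]
  exact integral_add (integrable_harmonicAddr h _) (integrable_harmonicAddr k _)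

theorem cutIntegral_smul (a : Fin 3) (c r : ℝ) (h : Fin 3 → ℝ) :
    cutIntegral a c (r • h) = r * cutIntegral a c h := by
  simp only [cutIntegral, harmonicAddr_smul]
  exact integral_const_mul _ _

theorem cutIntegral_perm (σ : Equiv.Perm (Fin 3)) (a : Fin 3) (c : ℝ) (h : Fin 3 → ℝ) :
    cutIntegral (σ a) c h = cutIntegral a c (h ∘ σ) := by
  have hm : Measurable fun (ω : ℕ → Fin 3) k => σ (ω k) := by
    refine measurable_pi_lambda _ fun k => ?_
    exact (measurable_of_countable σ).comp (measurable_pi_apply k)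
  rw [cutIntegral]
  conv_lhs => rw [← addrMeasure_map_perm σ]
  rw [setIntegral_map (measurableSet_height_le _ _)
    (continuous_harmonicAddr h).aestronglyMeasurable hm.aemeasurable]
  simp only [preimage_ofPred_eq, height_perm, harmonicAddr_perm, cutIntegral]

theorem cutIntegral_one (c : ℝ) : cutIntegral 0 c (fun _ => 1) = mass c := by
  have h1 : ∀ ω, harmonicAddr (fun _ => 1) ω = 1 := fun ω =>
    le_antisymm (harmonicAddr_le (fun _ => le_rfl) ω) (le_harmonicAddr (fun _ => le_rfl) ω)
  simp [cutIntegral, h1, mass]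

/-- The part is invariant under exchanging the two other vertices, so the corner values may be
symmetrized. The symmetric triples are spanned by the constant one and the one defining `moment`. -/
theorem cutIntegral_eq (a : Fin 3) (c : ℝ) (h : Fin 3 → ℝ) :
    cutIntegral a c h = h a * mass c + moment c * ((∑ j, h j - h a) / 2 - h a) := by
  have h0 : ∀ k : Fin 3 → ℝ,
      cutIntegral 0 c k = k 0 * mass c + moment c * ((∑ j, k j - k 0) / 2 - k 0) := by
    intro k
    have e1 := cutIntegral_perm (Equiv.swap 1 2) 0 c k
    have e2 : (Equiv.swap 1 2 : Equiv.Perm (Fin 3)) 0 = 0 := by decide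
    rw [e2] at e1
    have e3 : k + k ∘ (Equiv.swap 1 2 : Equiv.Perm (Fin 3)) = (2 * k 0) • (fun _ => (1 : ℝ)) +
        (k 1 + k 2 - 2 * k 0) • (fun j : Fin 3 => if j = 0 then (0 : ℝ) else 1) := by
      funext j
      fin_cases j
      · simp [e2]
        ring
      · simp
      · simp
        ring
    have e4 := congrArg (cutIntegral 0 c) e3
    rw [cutIntegral_add, cutIntegral_add, cutIntegral_smul, cutIntegral_smul, cutIntegral_one,
      ← e1, ← moment] at e4
    rw [Fin.sum_univ_three]
    linarith
  have h1 := cutIntegral_perm (Equiv.swap 0 a) 0 c h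
  rw [Equiv.swap_apply_left] at h1
  rw [h1, h0]
  simp only [Function.comp_apply, Equiv.swap_apply_left, Equiv.sum_comp (Equiv.swap 0 a) h]

/-! ### Recursions for mass and moment under rescaling -/

theorem cons_preimage_height_le (i : Fin 3) (c : ℝ) :
    cons i ⁻¹' {ω | height 0 ω ≤ c} = {ω | height 0 ω ≤ 2 * c - if i = 0 then 0 else 1} := by
  ext ω
  simp only [mem_preimage, mem_ofPred_eq, height_cons]
  constructor <;> intro h <;> linarith

theorem cutIntegral_rec (c : ℝ) (h : Fin 3 → ℝ) :
    cutIntegral 0 c h = 1 / 3 * (cutIntegral 0 (2 * c) (extend 0 h) +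
      cutIntegral 0 (2 * c - 1) (extend 1 h) + cutIntegral 0 (2 * c - 1) (extend 2 h)) := by
  rw [cutIntegral, setIntegral_addrMeasure (continuous_harmonicAddr h) (measurableSet_height_le _ _),
    Fin.sum_univ_three]
  simp only [cons_preimage_height_le, harmonicAddr_cons]
  simp [cutIntegral]

theorem mass_rec (c : ℝ) : mass c = 1 / 3 * mass (2 * c) + 2 / 3 * mass (2 * c - 1) := by
  have h := cutIntegral_rec c fun _ => 1
  rw [cutIntegral_one] at h
  simp only [cutIntegral_eq] at h
  simp [extend, Fin.sum_univ_three] at h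
  linarith

theorem moment_rec (c : ℝ) :
    moment c = 1 / 5 * moment (2 * c) + 2 / 5 * mass (2 * c - 1) + 1 / 5 * moment (2 * c - 1) := by
  have h := cutIntegral_rec c fun j => if j = 0 then 0 else 1
  rw [← moment] at h
  simp only [cutIntegral_eq] at h
  simp [extend, Fin.sum_univ_three] at h
  linarith

theorem mass_nonneg (c : ℝ) : 0 ≤ mass c := measureReal_nonneg

theorem mass_of_neg {c : ℝ} (hc : c < 0) : mass c = 0 := by
  have h : {ω | height 0 ω ≤ c} = ∅ := by
    ext ω
    simpa using hc.trans_le (height_nonneg 0 ω)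
  rw [mass, h, measureReal_empty]

theorem mass_of_one_le {c : ℝ} (hc : 1 ≤ c) : mass c = 1 := by
  have h : {ω | height 0 ω ≤ c} = univ := by
    ext ω
    simpa using (height_le_one 0 ω).trans hc
  rw [mass, h, probReal_univ]

theorem mass_mono : Monotone mass := fun _ _ h =>
  measureReal_mono fun _ hω => le_trans hω h

theorem mass_le_one (c : ℝ) : mass c ≤ 1 := measureReal_le_one

theorem moment_integrand_nonneg (ω : ℕ → Fin 3) :
    0 ≤ harmonicAddr (fun j => if j = 0 then 0 else 1) ω :=
  le_harmonicAddr (fun j => by split_ifs <;> norm_num) ω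

theorem moment_mono : Monotone moment := fun _ _ h =>
  setIntegral_mono_set (integrable_harmonicAddr _ _)
    (Filter.Eventually.of_forall moment_integrand_nonneg)
    (LE.le.eventuallyLE fun _ hω => le_trans hω h)

theorem moment_nonneg (c : ℝ) : 0 ≤ moment c :=
  integral_nonneg moment_integrand_nonneg

theorem moment_le_mass (c : ℝ) : moment c ≤ mass c := by
  have h : moment c ≤ ∫ _ in {ω | height 0 ω ≤ c}, (1 : ℝ) ∂addrMeasure :=
    integral_mono (integrable_harmonicAddr _ _) (integrable_const _) fun ω =>
      harmonicAddr_le (fun j => by split_ifs <;> norm_num) ω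
  simpa [mass] using h

theorem mass_zero : mass 0 = 0 := by
  have h := mass_rec 0
  rw [mass_of_neg (c := 2 * 0 - 1) (by norm_num), mul_zero] at h
  linarith

theorem mass_one : mass 1 = 1 := mass_of_one_le le_rfl

theorem moment_of_nonpos {c : ℝ} (hc : c ≤ 0) : moment c = 0 :=
  le_antisymm ((moment_le_mass c).trans ((mass_mono hc).trans mass_zero.le)) (moment_nonneg c)

theorem moment_of_one_le {c : ℝ} (hc : 1 ≤ c) : moment c = moment 1 := by
  have h : ∀ c : ℝ, 1 ≤ c → {ω | height 0 ω ≤ c} = univ := fun c hc => by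
    ext ω
    simpa using (height_le_one 0 ω).trans hc
  rw [moment, moment, cutIntegral, cutIntegral, h c hc, h 1 le_rfl]

theorem moment_one : moment 1 = 2 / 3 := by
  have h := moment_rec 1
  rw [moment_of_one_le (c := 2 * 1) (by norm_num)] at h
  norm_num [mass_one] at h
  linarith

theorem mass_of_le_half {c : ℝ} (hc : c ≤ 1 / 2) : mass c = 1 / 3 * mass (2 * c) := by
  have h1 := mass_mono (show 2 * c - 1 ≤ 0 by linarith)
  rw [mass_zero] at h1
  have h2 := mass_nonneg (2 * c - 1)
  rw [mass_rec c, le_antisymm h1 h2]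
  ring

theorem mass_of_half_le {c : ℝ} (hc : 1 / 2 ≤ c) : mass c = 1 / 3 + 2 / 3 * mass (2 * c - 1) := by
  rw [mass_rec c, mass_of_one_le (c := 2 * c) (by linarith)]
  ring

theorem moment_of_le_half {c : ℝ} (hc : c ≤ 1 / 2) : moment c = 1 / 5 * moment (2 * c) := by
  have h1 := mass_mono (show 2 * c - 1 ≤ 0 by linarith)
  rw [mass_zero] at h1
  have h2 := mass_nonneg (2 * c - 1)
  rw [moment_rec c, le_antisymm h1 h2, moment_of_nonpos (c := 2 * c - 1) (by linarith)]
  ring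

theorem moment_of_half_le {c : ℝ} (hc : 1 / 2 ≤ c) :
    moment c = 2 / 15 + 2 / 5 * mass (2 * c - 1) + 1 / 5 * moment (2 * c - 1) := by
  rw [moment_rec c, moment_of_one_le (c := 2 * c) (by linarith), moment_one]
  ring

/-! ### Continuity -/

theorem addrMeasure_real_apply {s : Set (ℕ → Fin 3)} (hs : MeasurableSet s) :
    addrMeasure.real s = 1 / 3 * ∑ i, addrMeasure.real (cons i ⁻¹' s) := by
  simpa using setIntegral_addrMeasure (continuous_const (y := (1 : ℝ))) hs

/-- For $c\ne\frac12$ only one of the levels $2c$, $2c-1$ lies in $[0,1]$, so each rescaling gains a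
factor of at most 2/3. At $c=\frac12$ these levels are 1 and 0, which are null by their own
recursions. -/
theorem addrMeasure_real_height_eq_le (n : ℕ) (c : ℝ) :
    addrMeasure.real {ω | height 0 ω = c} ≤ (2 / 3) ^ n := by
  have hpre : ∀ i c, cons i ⁻¹' {ω | height 0 ω = c} =
      {ω | height 0 ω = 2 * c - if i = 0 then 0 else 1} := by
    intro i c
    ext ω
    simp only [mem_preimage, mem_ofPred_eq, height_cons]
    constructor <;> intro h <;> linarith
  have hrec : ∀ c, addrMeasure.real {ω | height 0 ω = c} =
      1 / 3 * addrMeasure.real {ω | height 0 ω = 2 * c} +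
        2 / 3 * addrMeasure.real {ω | height 0 ω = 2 * c - 1} := by
    intro c
    rw [addrMeasure_real_apply (isClosed_eq (continuous_height 0) continuous_const).measurableSet,
      Fin.sum_univ_three, hpre, hpre, hpre]
    simp
    ring
  have hout : ∀ c, c < 0 ∨ 1 < c → addrMeasure.real {ω | height 0 ω = c} = 0 := by
    intro c hc
    have h : {ω | height 0 ω = c} = ∅ := by
      ext ω
      simp only [mem_ofPred_eq, mem_empty_iff_false, iff_false]
      have h1 := height_nonneg 0 ω
      have h2 := height_le_one 0 ω
      rintro rfl
      rcases hc with hc | hc <;> linarith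
    rw [h, measureReal_empty]
  have h0 : addrMeasure.real {ω | height 0 ω = 0} = 0 := by
    have h := hrec 0
    rw [hout (2 * 0 - 1) (by norm_num), mul_zero] at h
    linarith
  have h1 : addrMeasure.real {ω | height 0 ω = 1} = 0 := by
    have h := hrec 1
    rw [hout (2 * 1) (by norm_num), show (2 * 1 - 1 : ℝ) = 1 by norm_num] at h
    linarith
  induction n generalizing c with
  | zero => simp
  | succ n ih =>
    have hnn : ∀ c, 0 ≤ addrMeasure.real {ω | height 0 ω = c} := fun c => measureReal_nonneg
    rw [hrec c, pow_succ']
    rcases lt_trichotomy c (1 / 2) with hc | hc | hc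
    · rw [hout (2 * c - 1) (Or.inl (by linarith))]
      linarith [ih (2 * c), hnn (2 * c)]
    · rw [hc, show (2 * (1 / 2) : ℝ) = 1 by norm_num, sub_self, h0, h1, mul_zero, mul_zero,
        add_zero]
      positivity
    · rw [hout (2 * c) (Or.inr (by linarith))]
      linarith [ih (2 * c - 1)]

theorem ae_height_ne (c : ℝ) : ∀ᵐ ω ∂addrMeasure, height 0 ω ≠ c := by
  have h := ge_of_tendsto' (tendsto_pow_atTop_nhds_zero_of_lt_one (r := (2 / 3 : ℝ)) (by norm_num)
    (by norm_num)) fun n => addrMeasure_real_height_eq_le n c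
  have h2 : addrMeasure.real {ω | height 0 ω = c} = 0 := le_antisymm h measureReal_nonneg
  rw [measureReal_def, ENNReal.toReal_eq_zero_iff] at h2
  rw [ae_iff]
  simpa using h2.resolve_right (measure_ne_top _ _)

/-- Off the null set of height exactly $c$, the indicator is locally constant in the parameter, so
dominated convergence applies. -/
theorem continuous_cutIntegral (h : Fin 3 → ℝ) : Continuous fun c => cutIntegral 0 c h := by
  rw [continuous_iff_continuousAt]
  intro c
  obtain ⟨C, hC⟩ := isCompact_univ.exists_bound_of_continuousOn
    (continuous_harmonicAddr h).continuousOn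
  have e : (fun c => cutIntegral 0 c h) =
      fun c => ∫ ω, indicator {ω | height 0 ω ≤ c} (harmonicAddr h) ω ∂addrMeasure :=
    funext fun c => (integral_indicator (measurableSet_height_le 0 c)).symm
  rw [e]
  refine continuousAt_of_dominated (bound := fun _ => C) ?_ ?_ (integrable_const C) ?_
  · exact Filter.Eventually.of_forall fun c =>
      (continuous_harmonicAddr h).aestronglyMeasurable.indicator (measurableSet_height_le 0 c)
  · refine Filter.Eventually.of_forall fun c => Filter.Eventually.of_forall fun ω => ?_
    exact (norm_indicator_le_norm_self _ _).trans (hC ω (mem_univ ω))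
  · filter_upwards [ae_height_ne c] with ω hω
    rcases lt_or_gt_of_ne hω with h1 | h1
    · refine (continuousAt_const (y := harmonicAddr h ω)).congr ?_
      filter_upwards [lt_mem_nhds h1] with d hd
      exact (indicator_of_mem (show ω ∈ {ω | height 0 ω ≤ d} from hd.le) _).symm
    · refine (continuousAt_const (y := (0 : ℝ))).congr ?_
      filter_upwards [gt_mem_nhds h1] with d hd
      exact (indicator_of_notMem (show ω ∉ {ω | height 0 ω ≤ d} from not_le.2 hd) _).symm

theorem continuous_mass : Continuous mass := by
  simpa only [cutIntegral_one] using continuous_cutIntegral fun _ => 1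

theorem continuous_moment : Continuous moment := continuous_cutIntegral _

/-! ### Monotonicity -/

theorem mass_pos {c : ℝ} (hc : 0 < c) : 0 < mass c := by
  obtain ⟨n, hn⟩ := exists_pow_lt_of_lt_one hc (show (1 / 2 : ℝ) < 1 by norm_num)
  clear hc
  induction n generalizing c with
  | zero =>
    rw [mass_of_one_le (by simpa using hn.le)]
    norm_num
  | succ n ih =>
    have h1 : 0 < mass (2 * c) := ih (by rw [pow_succ] at hn; linarith)
    rw [mass_rec c]
    linarith [mass_nonneg (2 * c - 1)]

theorem mass_strictMonoOn : StrictMonoOn mass (Icc 0 1) := by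
  -- Rescaling doubles the gap as long as $x$ and $y$ lie on the same side of 1/2. If 1/2 separates
  -- them, then `mass x` $\le\frac13<$ `mass y`.
  have key : ∀ n : ℕ, ∀ x y : ℝ, 0 ≤ x → y ≤ 1 → (1 / 2) ^ n < y - x → mass x < mass y := by
    intro n
    induction n with
    | zero =>
      intro x y hx hy h
      norm_num at h
      linarith
    | succ n ih =>
      intro x y hx hy h
      rw [pow_succ] at h
      have hp : (0 : ℝ) < (1 / 2) ^ n := by positivity
      rcases le_or_gt y (1 / 2) with hy2 | hy2
      · rw [mass_of_le_half hy2, mass_of_le_half (by linarith : x ≤ 1 / 2)]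
        linarith [ih (2 * x) (2 * y) (by linarith) (by linarith) (by linarith)]
      · rcases le_or_gt (1 / 2) x with hx2 | hx2
        · rw [mass_of_half_le hy2.le, mass_of_half_le hx2]
          linarith [ih (2 * x - 1) (2 * y - 1) (by linarith) (by linarith) (by linarith)]
        · rw [mass_of_half_le hy2.le, mass_of_le_half hx2.le]
          linarith [mass_pos (show 0 < 2 * y - 1 by linarith), mass_le_one (2 * x)]
  intro x hx y hy hxy
  obtain ⟨n, hn⟩ := exists_pow_lt_of_lt_one (sub_pos.2 hxy) (show (1 / 2 : ℝ) < 1 by norm_num)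
  exact key n x y hx.1 hy.2 hn

/-- The mean value `moment c / mass c` is nondecreasing. -/
theorem moment_mul_mass_le {x y : ℝ} (hx : 0 ≤ x) (hxy : x ≤ y) (hy : y ≤ 1) :
    moment x * mass y ≤ moment y * mass x := by
  -- The possible excess of the cross difference shrinks at every rescaling; 2/5 is a rate that
  -- covers all three positions relative to 1/2.
  have key : ∀ n : ℕ, ∀ x y : ℝ, 0 ≤ x → x ≤ y → y ≤ 1 →
      moment x * mass y - moment y * mass x ≤ (2 / 5) ^ n := by
    intro n
    induction n with
    | zero =>
      intro x y _ _ _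
      have h1 := mul_le_one₀ ((moment_le_mass x).trans (mass_le_one x)) (mass_nonneg y)
        (mass_le_one y)
      have h2 := mul_nonneg (moment_nonneg y) (mass_nonneg x)
      rw [pow_zero]
      linarith
    | succ n ih =>
      intro x y hx hxy hy
      have hp : (0 : ℝ) < (2 / 5) ^ n := by positivity
      rw [pow_succ]
      rcases le_or_gt y (1 / 2) with hy2 | hy2
      · rw [mass_of_le_half hy2, moment_of_le_half hy2, mass_of_le_half (hxy.trans hy2),
          moment_of_le_half (hxy.trans hy2)]
        nlinarith [ih (2 * x) (2 * y) (by linarith) (by linarith) (by linarith)]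
      · rcases le_or_gt (1 / 2) x with hx2 | hx2
        · rw [mass_of_half_le hy2.le, moment_of_half_le hy2.le, mass_of_half_le hx2,
            moment_of_half_le hx2]
          have h1 := ih (2 * x - 1) (2 * y - 1) (by linarith) (by linarith) (by linarith)
          have h2 := mass_mono (show 2 * x - 1 ≤ 2 * y - 1 by linarith)
          have h3 := moment_mono (show 2 * x - 1 ≤ 2 * y - 1 by linarith)
          nlinarith
        · rw [mass_of_half_le hy2.le, moment_of_half_le hy2.le, mass_of_le_half hx2.le,
            moment_of_le_half hx2.le]
          -- With 1/2 between $x$ and $y$ the rescaled points are unrelated, so $2x$ is compared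
          -- with 1, where `moment/mass` is 2/3.
          have h1 := ih (2 * x) 1 (by linarith) (by linarith) le_rfl
          rw [mass_one, moment_one] at h1
          have h2 := mass_nonneg (2 * x)
          have h3 := mass_nonneg (2 * y - 1)
          have h4 := mass_le_one (2 * y - 1)
          have h5 := moment_nonneg (2 * y - 1)
          have h6 := mul_le_mul_of_nonneg_right h1 (show 0 ≤ 1 + 2 * mass (2 * y - 1) by linarith)
          have h7 := mul_nonneg h2 h3
          have h8 := mul_nonneg h2 h5
          have h9 := mul_nonneg hp.le (sub_nonneg.2 h4)
          nlinarith
  have h := ge_of_tendsto' (tendsto_pow_atTop_nhds_zero_of_lt_one (r := (2 / 5 : ℝ)) (by norm_num)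
    (by norm_num)) fun n => key n x y hx hxy hy
  linarith

/-! ### The coefficient map in terms of the parameters -/

/-- The weight with which a cut-off part of parameter `c` enters the coefficients. -/
noncomputable def weight (c : ℝ) : ℝ := mass c + 3 / 2 * moment c

theorem continuous_weight : Continuous weight :=
  continuous_mass.add (continuous_moment.const_mul _)

theorem weight_strictMonoOn : StrictMonoOn weight (Icc 0 1) := fun x hx y hy hxy => by
  have h1 := mass_strictMonoOn hx hy hxy
  have h2 := moment_mono hxy.le
  unfold weight
  linarith

theorem weight_zero : weight 0 = 0 := by
  rw [weight, mass_zero, moment_of_nonpos le_rfl]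
  norm_num

theorem weight_one : weight 1 = 2 := by
  rw [weight, mass_one, moment_one]
  norm_num

theorem weight_nonneg (c : ℝ) : 0 ≤ weight c := by
  have h1 := mass_nonneg c
  have h2 := moment_nonneg c
  unfold weight
  linarith

theorem mass_le_weight (c : ℝ) : mass c ≤ weight c := by
  have h2 := moment_nonneg c
  unfold weight
  linarith

theorem weight_mul_mass_le {x y : ℝ} (hx : 0 ≤ x) (hxy : x ≤ y) (hy : y ≤ 1) :
    weight x * mass y ≤ weight y * mass x := by
  have := moment_mul_mass_le hx hxy hy
  unfold weight
  linarith

theorem exists_weight_eq {z : ℝ} (h0 : 0 ≤ z) (h2 : z ≤ 2) : ∃ x ∈ Icc (0 : ℝ) 1, weight x = z := by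
  have := intermediate_value_Icc (zero_le_one' ℝ) continuous_weight.continuousOn
  rw [weight_zero, weight_one] at this
  exact this ⟨h0, h2⟩

/-- The function `weight` has a continuous inverse. -/
theorem exists_continuousOn_inverse_weight :
    ∃ χ : ℝ → ℝ, ContinuousOn χ (Icc 0 2) ∧
      ∀ z ∈ Icc (0 : ℝ) 2, χ z ∈ Icc (0 : ℝ) 1 ∧ weight (χ z) = z := by
  let f : Icc (0 : ℝ) 1 → ℝ := fun x => weight x
  have hf : Topology.IsClosedEmbedding f :=
    (continuous_weight.comp continuous_subtype_val).isClosedEmbedding fun x y hxy =>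
      Subtype.ext (weight_strictMonoOn.injOn x.2 y.2 hxy)
  have hmem : ∀ z ∈ Icc (0 : ℝ) 2, z ∈ range f := fun z hz => by
    obtain ⟨x, hx, rfl⟩ := exists_weight_eq hz.1 hz.2
    exact ⟨⟨x, hx⟩, rfl⟩
  let χ' : Icc (0 : ℝ) 2 → Icc (0 : ℝ) 1 := fun z =>
    hf.isEmbedding.toHomeomorph.symm ⟨z, hmem z z.2⟩
  have hχ' : Continuous χ' := hf.isEmbedding.toHomeomorph.symm.continuous.comp
    (continuous_subtype_val.subtype_mk _)
  have hw : ∀ z, weight (χ' z) = z := fun z =>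
    congrArg Subtype.val (hf.isEmbedding.toHomeomorph.apply_symm_apply ⟨z, hmem z z.2⟩)
  refine ⟨fun z => χ' (projIcc 0 2 zero_le_two z), ?_, fun z hz => ⟨Subtype.coe_prop _, ?_⟩⟩
  · exact (continuous_subtype_val.comp (hχ'.comp continuous_projIcc)).continuousOn
  · rw [hw, projIcc_of_mem zero_le_two hz]

/-- The total normalized mass of the set with parameters `c`. -/
noncomputable def totalMass (c : Fin 3 → ℝ) : ℝ := 1 + ∑ i, mass (c i)

/-- The normalized weights. -/
noncomputable def ratio (c : Fin 3 → ℝ) (j : Fin 3) : ℝ := weight (c j) / totalMass c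

/-- The coefficient vector of the set with parameters `c`. -/
noncomputable def coeff (c : Fin 3 → ℝ) (j : Fin 3) : ℝ :=
  1 / 3 + (ratio c j - (∑ i, ratio c i) / 3)

theorem one_le_totalMass (c : Fin 3 → ℝ) : 1 ≤ totalMass c :=
  le_add_of_nonneg_right (Finset.sum_nonneg fun i _ => mass_nonneg (c i))

theorem totalMass_pos (c : Fin 3 → ℝ) : 0 < totalMass c := one_pos.trans_le (one_le_totalMass c)

theorem ratio_nonneg (c : Fin 3 → ℝ) (j : Fin 3) : 0 ≤ ratio c j :=
  div_nonneg (weight_nonneg _) (totalMass_pos c).le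

theorem coeff_mem_planeW (c : Fin 3 → ℝ) : coeff c ∈ planeW := by
  change ∑ i, coeff c i = 1
  simp only [coeff, Fin.sum_univ_three]
  ring

theorem coeff_eq_coeff {c c' : Fin 3 → ℝ} {t : ℝ} (h : ∀ j, ratio c j = ratio c' j - t) :
    coeff c = coeff c' := by
  funext j
  simp only [coeff, Fin.sum_univ_three, h]
  ring

theorem coeff_injOn : InjOn coeff LamStar := by
  have hzero : ∀ c ∈ LamStar, ∃ i, ratio c i = 0 := by
    rintro c ⟨-, i, hi⟩
    exact ⟨i, by rw [ratio, hi, weight_zero, zero_div]⟩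
  -- The two ratio vectors differ by a constant, and both are nonnegative with a zero entry.
  have hratio : ∀ c ∈ LamStar, ∀ c' ∈ LamStar, coeff c = coeff c' → ∀ j, ratio c j = ratio c' j := by
    intro c hc c' hc' h j
    obtain ⟨i, hi⟩ := hzero c hc
    obtain ⟨i', hi'⟩ := hzero c' hc'
    have h1 := congrFun h i
    have h2 := congrFun h i'
    have h3 := congrFun h j
    simp only [coeff] at h1 h2 h3
    have h4 := ratio_nonneg c i'
    have h5 := ratio_nonneg c' i
    linarith
  have key : ∀ c ∈ LamStar, ∀ c' ∈ LamStar, (∀ j, ratio c j = ratio c' j) →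
      totalMass c ≤ totalMass c' → c = c' := by
    intro c hc c' hc' h hle
    have hp := totalMass_pos c
    have hp' := totalMass_pos c'
    have hw : ∀ j, weight (c j) * totalMass c' = weight (c' j) * totalMass c := fun j =>
      (div_eq_div_iff hp.ne' hp'.ne').1 (h j)
    have hcc : ∀ j, c j ≤ c' j := fun j => by
      rw [← weight_strictMonoOn.le_iff_le (hc.1 j) (hc'.1 j)]
      nlinarith [hw j, weight_nonneg (c j), weight_nonneg (c' j)]
    -- Since `mass/weight` is nonincreasing, the masses grow at most by the factor by which the
    -- weights grow, namely $M'/M$.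
    have hm : ∀ j, mass (c' j) * totalMass c ≤ mass (c j) * totalMass c' := fun j => by
      have h1 := weight_mul_mass_le (hc.1 j).1 (hcc j) (hc'.1 j).2
      rcases (weight_nonneg (c j)).eq_or_lt' with h0 | h0
      · have h2 := hw j
        rw [h0, zero_mul] at h2
        have h3 : weight (c' j) = 0 := (mul_eq_zero.1 h2.symm).resolve_right hp.ne'
        have h4 : mass (c' j) = 0 := le_antisymm (h3 ▸ mass_le_weight _) (mass_nonneg _)
        rw [h4, zero_mul]
        exact mul_nonneg (mass_nonneg _) hp'.le
      · refine le_of_mul_le_mul_left ?_ h0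
        calc weight (c j) * (mass (c' j) * totalMass c)
            = weight (c j) * mass (c' j) * totalMass c := by ring
          _ ≤ weight (c' j) * mass (c j) * totalMass c := by gcongr
          _ = weight (c j) * (mass (c j) * totalMass c') := by
            linear_combination (-mass (c j)) * hw j
    -- Summing leaves out the contribution 1 of $C_w$, which does not scale; this forces $M'\le M$.
    have hsum : (totalMass c' - 1) * totalMass c ≤ (totalMass c - 1) * totalMass c' := by
      simp only [totalMass, add_sub_cancel_left, Finset.sum_mul]
      exact Finset.sum_le_sum fun j _ => hm j
    have heq : totalMass c = totalMass c' := le_antisymm hle (by linarith)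
    funext j
    refine weight_strictMonoOn.injOn (hc.1 j) (hc'.1 j) ?_
    have h1 := hw j
    rw [heq] at h1
    exact mul_right_cancel₀ hp'.ne' h1
  intro c hc c' hc' h
  rcases le_total (totalMass c) (totalMass c') with hle | hle
  · exact key c hc c' hc' (hratio c hc c' hc' h) hle
  · exact (key c' hc' c hc (hratio c' hc' c hc h.symm) hle).symm

/-- Every short multiple of the weights of a parameter with a zero entry is realized. -/
theorem exists_ratio_eq {d : Fin 3 → ℝ} (hd : d ∈ LamStar) {r : ℝ} (hr : 0 ≤ r)
    (hrd : r * totalMass d ≤ 1) : ∃ c ∈ LamStar, ∀ j, ratio c j = r * weight (d j) := by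
  obtain ⟨χ, hχ, hχw⟩ := exists_continuousOn_inverse_weight
  have hw2 : ∀ j, weight (d j) ≤ 2 := fun j => by
    rw [← weight_one]
    exact weight_strictMonoOn.monotoneOn (hd.1 j) ⟨zero_le_one, le_rfl⟩ (hd.1 j).2
  have hmem : ∀ j, ∀ l ∈ Icc (0 : ℝ) 1, l * weight (d j) ∈ Icc (0 : ℝ) 2 := fun j l hl =>
    ⟨mul_nonneg hl.1 (weight_nonneg _), by nlinarith [hl.1, hl.2, hw2 j, weight_nonneg (d j)]⟩
  have hc1 : ∀ j, χ (1 * weight (d j)) = d j := fun j => by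
    obtain ⟨h1, h2⟩ := hχw _ (hmem j 1 ⟨zero_le_one, le_rfl⟩)
    refine weight_strictMonoOn.injOn h1 (hd.1 j) ?_
    rw [h2, one_mul]
  -- Scaling all weights by $l$ keeps their proportions. The common factor of the ratios runs
  -- continuously from 0 at $l=0$ to $1/$ `totalMass d` at $l=1$.
  have hcont : ContinuousOn (fun l => l / totalMass fun j => χ (l * weight (d j)))
      (Icc (0 : ℝ) 1) := by
    refine continuousOn_id.div ?_ fun l _ => (totalMass_pos _).ne'
    refine continuousOn_const.add (continuousOn_finsetSum _ fun j _ => ?_)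
    refine continuous_mass.comp_continuousOn (hχ.comp (by fun_prop) (hmem j))
  have hivt := intermediate_value_Icc (zero_le_one' ℝ) hcont
  simp only [zero_div, hc1] at hivt
  obtain ⟨l, hl, hlr⟩ := hivt ⟨hr, (le_div_iff₀ (totalMass_pos d)).2 hrd⟩
  refine ⟨fun j => χ (l * weight (d j)), ⟨fun j => (hχw _ (hmem j l hl)).1, ?_⟩, fun j => ?_⟩
  · obtain ⟨i, hi⟩ := hd.2
    refine ⟨i, ?_⟩
    obtain ⟨h1, h2⟩ := hχw _ (hmem i l hl)
    refine weight_strictMonoOn.injOn h1 ⟨le_rfl, zero_le_one⟩ ?_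
    rw [h2, hi, weight_zero, mul_zero]
  · rw [ratio, (hχw _ (hmem j l hl)).2, ← hlr]
    ring

/-- Subtracting the least weight from all weights shifts the ratios by a constant if the old total
mass is kept as denominator. The new total mass is no larger, so `exists_ratio_eq` can realize these
ratios. -/
theorem coeff_image_LamStar : coeff '' LamStar = coeff '' Lam := by
  refine Subset.antisymm (image_mono fun c hc => hc.1) ?_
  rintro _ ⟨c, hc, rfl⟩
  obtain ⟨i, hi⟩ := Finite.exists_min fun j => weight (c j)
  have hw2 : ∀ j, weight (c j) ≤ 2 := fun j => by
    rw [← weight_one]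
    exact weight_strictMonoOn.monotoneOn (hc j) ⟨zero_le_one, le_rfl⟩ (hc j).2
  have hex : ∀ j, ∃ x ∈ Icc (0 : ℝ) 1, weight x = weight (c j) - weight (c i) := fun j =>
    exists_weight_eq (sub_nonneg.2 (hi j)) (by linarith [hw2 j, weight_nonneg (c i)])
  choose d hd hdw using hex
  have hdi : d i = 0 := by
    refine weight_strictMonoOn.injOn (hd i) ⟨le_rfl, zero_le_one⟩ ?_
    rw [hdw, sub_self, weight_zero]
  have hdc : ∀ j, d j ≤ c j := fun j => by
    rw [← weight_strictMonoOn.le_iff_le (hd j) (hc j), hdw]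
    linarith [weight_nonneg (c i)]
  have hmass : totalMass d ≤ totalMass c := by
    unfold totalMass
    gcongr with j _
    exact mass_mono (hdc j)
  obtain ⟨c', hc', h⟩ := exists_ratio_eq (d := d) ⟨hd, i, hdi⟩ (r := (totalMass c)⁻¹)
    (inv_nonneg.2 (totalMass_pos c).le) (by
      rw [inv_mul_le_iff₀ (totalMass_pos c), mul_one]
      exact hmass)
  refine ⟨c', hc', coeff_eq_coeff (t := weight (c i) / totalMass c) fun j => ?_⟩
  rw [h, hdw, ratio]
  ring

theorem stdSimplex_subset_coeff_image : stdSimplex ℝ (Fin 3) ⊆ coeff '' Lam := by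
  intro a ha
  rw [← coeff_image_LamStar]
  obtain ⟨i, hi⟩ := Finite.exists_min a
  obtain ⟨k, hk⟩ := Finite.exists_max a
  have hsum : a 0 + a 1 + a 2 = 1 := by
    rw [← Fin.sum_univ_three]
    exact ha.2
  suffices h : ∃ c ∈ LamStar, ∀ j, ratio c j = a j - a i by
    obtain ⟨c, hc, h⟩ := h
    refine ⟨c, hc, ?_⟩
    funext j
    simp only [coeff, Fin.sum_univ_three, h]
    linarith
  rcases (hi k).eq_or_lt with heq | hlt
  · refine ⟨fun _ => 0, ⟨fun _ => ⟨le_rfl, zero_le_one⟩, 0, rfl⟩, fun j => ?_⟩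
    rw [ratio, weight_zero, zero_div]
    linarith [hi j, hk j]
  have hX : 0 < a k - a i := sub_pos.2 hlt
  -- The required ratios $a_j-a_i$ are stretched until the largest weight is 2, the value of
  -- `weight` at 1.
  have hex : ∀ j, ∃ x ∈ Icc (0 : ℝ) 1, weight x = 2 * (a j - a i) / (a k - a i) := fun j =>
    exists_weight_eq (div_nonneg (by linarith [hi j]) hX.le)
      ((div_le_iff₀ hX).2 (by linarith [hk j]))
  choose d hd hdw using hex
  have hdi : d i = 0 := by
    refine weight_strictMonoOn.injOn (hd i) ⟨le_rfl, zero_le_one⟩ ?_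
    rw [hdw, sub_self, mul_zero, zero_div, weight_zero]
  have hdk : d k = 1 := by
    refine weight_strictMonoOn.injOn (hd k) ⟨zero_le_one, le_rfl⟩ ?_
    rw [hdw, weight_one, mul_div_assoc, div_self hX.ne', mul_one]
  -- At $k$ the weight 2 pays for the mass 1 and also for the summand 1 in `totalMass`; elsewhere
  -- mass is at most weight. The weights times $r$ sum to $1-3a_i$, and this is where $a_i\ge0$
  -- enters.
  have hmass : totalMass d ≤ ∑ j, weight (d j) := by
    rw [totalMass, ← Finset.add_sum_erase _ _ (Finset.mem_univ k),
      ← Finset.add_sum_erase _ (fun j => weight (d j)) (Finset.mem_univ k), hdk, mass_one,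
      weight_one]
    have := Finset.sum_le_sum fun j (_ : j ∈ Finset.univ.erase k) => mass_le_weight (d j)
    linarith
  obtain ⟨c, hc, h⟩ := exists_ratio_eq (d := d) ⟨hd, i, hdi⟩ (r := (a k - a i) / 2)
    (by linarith) (by
      calc (a k - a i) / 2 * totalMass d ≤ (a k - a i) / 2 * ∑ j, weight (d j) := by gcongr
        _ = 1 - 3 * a i := by
          simp only [hdw, Fin.sum_univ_three]
          field_simp
          linarith
        _ ≤ 1 := by linarith [ha.1 i])
  refine ⟨c, hc, fun j => ?_⟩
  rw [h, hdw]
  field_simp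

/-! ### The mean values over the sets `B(c)` -/

/-- The part of height at most `c` of the gasket, seen from the vertex `a`. -/
def lowerPart (q : Fin 3 → Plane) (a : Fin 3) (c : ℝ) : Set Plane :=
  {y ∈ SG q | 1 - bary q a y ≤ c}

theorem lowerPart_subset (q : Fin 3 → Plane) (a : Fin 3) (c : ℝ) : lowerPart q a c ⊆ SG q :=
  fun _ h => h.1

theorem measurableSet_lowerPart (q : Fin 3 → Plane) (a : Fin 3) (c : ℝ) :
    MeasurableSet (lowerPart q a c) :=
  (measurableSet_SG q).inter
    (isClosed_le (continuous_const.sub (continuous_bary q a)) continuous_const).measurableSet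

theorem addr_preimage_lowerPart {q : Fin 3 → Plane} (hq : IsEquilateral q) (a : Fin 3) (c : ℝ) :
    addr q ⁻¹' lowerPart q a c = {ω | height a ω ≤ c} := by
  ext ω
  simp only [lowerPart, mem_preimage, mem_ofPred_eq, one_sub_bary_addr hq]
  exact and_iff_right ⟨ω, rfl⟩

theorem setIntegral_lowerPart {q : Fin 3 → Plane} (hq : IsEquilateral q) {h : Plane → ℝ}
    (hh : IsHarmonic q h) (v : List (Fin 3)) (a : Fin 3) (c : ℝ) :
    ∫ x in Fw q v '' lowerPart q a c, h x ∂mu q =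
      (1 / 3) ^ v.length * cutIntegral a c (extendWord v fun i => h (q i)) := by
  have hc : ContinuousOn (fun x => h (Fw q v x)) (SG q) :=
    hh.1.comp (continuous_Fw q v).continuousOn fun x hx => Fw_mem_SG q v hx
  rw [setIntegral_Fw_image hq v (measurableSet_lowerPart q a c) (lowerPart_subset q a c),
    setIntegral_mu hc (measurableSet_lowerPart q a c), addr_preimage_lowerPart hq]
  simp only [hh.Fw_addr hq, cutIntegral]

theorem lowerPart_one {q : Fin 3 → Plane} (hq : IsEquilateral q) (a : Fin 3) :
    lowerPart q a 1 = SG q :=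
  Subset.antisymm (lowerPart_subset q a 1) fun x hx => ⟨hx, by linarith [bary_nonneg hq hx a]⟩

theorem setIntegral_cell {q : Fin 3 → Plane} (hq : IsEquilateral q) {h : Plane → ℝ}
    (hh : IsHarmonic q h) (w : List (Fin 3)) :
    ∫ x in cell q w, h x ∂mu q = (1 / 3) ^ w.length * ((∑ i, h (corner q w i)) / 3) := by
  have h1 := setIntegral_lowerPart hq hh w 0 1
  rw [lowerPart_one hq, cutIntegral_eq, mass_one, moment_one] at h1
  rw [cell, h1]
  simp only [hh.corner hq]
  ring

theorem harmonicExt_one {q : Fin 3 → Plane} (hq : IsEquilateral q) {x : Plane} (hx : x ∈ SG q) :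
    harmonicExt q (fun _ => 1) x = 1 := by
  obtain ⟨ω, rfl⟩ := hx
  rw [harmonicExt_addr hq]
  exact le_antisymm (harmonicAddr_le (fun _ => le_rfl) ω) (le_harmonicAddr (fun _ => le_rfl) ω)

/-- Masses are thus special cases of the integral formulas for harmonic functions. -/
theorem measureReal_eq_setIntegral {q : Fin 3 → Plane} (hq : IsEquilateral q) {s : Set Plane}
    (hs : MeasurableSet s) (hsub : s ⊆ SG q) :
    (mu q).real s = ∫ x in s, harmonicExt q (fun _ => 1) x ∂mu q := by
  rw [setIntegral_congr_fun hs fun x hx => harmonicExt_one hq (hsub hx)]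
  simp

/-- The words `v i` address the neighbors of `C_w` at the corners `p_i`, and `p_i` is the corner
with index `a i` of its neighbor. -/
structure NeighborWords (q : Fin 3 → Plane) (w : List (Fin 3)) (v : Fin 3 → List (Fin 3))
    (a : Fin 3 → Fin 3) : Prop where
  isNeighbor_iff : ∀ i v', IsNeighbor q w i v' ↔ v' = v i
  corner_eq : ∀ i, corner q w i = corner q (v i) (a i)
  extendWord_eq : ∀ i h, extendWord (v i) h (a i) = extendWord w h i
  sum_extendWord : ∀ i h, ∑ j, extendWord w h j + ∑ j, extendWord (v i) h j = 6 * extendWord w h i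

theorem exists_neighborWords {q : Fin 3 → Plane} (hq : IsEquilateral q) {w : List (Fin 3)}
    (hw : cell q w ∩ V q 0 = ∅) : ∃ v a, NeighborWords q w v a := by
  have h := exists_word_decomposition_of_disjoint hw
  choose u a n hai hu using h
  refine ⟨fun i => u i ++ i :: List.replicate (n i) (a i), a, ⟨fun i v' => ?_, fun i => ?_,
    fun i h => ?_, fun i h => ?_⟩⟩
  · nth_rewrite 1 [hu i]
    exact SGasket.isNeighbor_iff hq (hai i) (n i) (u i) v'
  · nth_rewrite 1 [hu i]
    exact corner_eq_corner_neighbor q (u i) (a i) i (n i)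
  · nth_rewrite 1 [hu i]
    rw [extendWord_corner, extendWord_corner, extend_comm]
  · rw [hu i]
    exact sum_extendWord_neighbor (u i) (hai i) (n i) h

namespace NeighborWords

variable {q : Fin 3 → Plane} {w : List (Fin 3)} {v : Fin 3 → List (Fin 3)} {a : Fin 3 → Fin 3}

theorem length_eq (hv : NeighborWords q w v a) (i : Fin 3) : (v i).length = w.length :=
  ((hv.isNeighbor_iff i _).2 rfl).1

theorem inter_eq (hv : NeighborWords q w v a) (i : Fin 3) :
    cell q (v i) ∩ cell q w = {corner q w i} := ((hv.isNeighbor_iff i _).2 rfl).2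

theorem E_eq (hv : NeighborWords q w v a) (hq : IsEquilateral q) (i : Fin 3) (c : ℝ) :
    E q w i c = Fw q (v i) '' lowerPart q (a i) c := by
  simp only [E, hv.isNeighbor_iff, iUnion_iUnion_eq_left]
  rw [hv.corner_eq i, cut_eq hq (hv.length_eq i)]
  rfl

theorem E_subset (hv : NeighborWords q w v a) (hq : IsEquilateral q) (i : Fin 3) (c : ℝ) :
    E q w i c ⊆ cell q (v i) := by
  rw [hv.E_eq hq]
  exact image_mono (lowerPart_subset q _ _)

theorem measurableSet_E (hv : NeighborWords q w v a) (hq : IsEquilateral q) (i : Fin 3) (c : ℝ) :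
    MeasurableSet (E q w i c) := by
  rw [hv.E_eq hq]
  exact (measurableEmbedding_Fw q (v i)).measurableSet_image.2 (measurableSet_lowerPart q _ _)

theorem mu_cell_inter (hv : NeighborWords q w v a) (hq : IsEquilateral q) (i : Fin 3) :
    mu q (cell q w ∩ cell q (v i)) = 0 := by
  rw [inter_comm, hv.inter_eq]
  exact mu_corner hq w i

theorem mu_inter (hv : NeighborWords q w v a) (hq : IsEquilateral q) {i j : Fin 3} (hij : i ≠ j) :
    mu q (cell q (v i) ∩ cell q (v j)) = 0 := by
  refine mu_cell_inter_cell hq ((hv.length_eq i).trans (hv.length_eq j).symm) fun h => hij ?_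
  have h1 := hv.inter_eq i
  rw [h, hv.inter_eq j, singleton_eq_singleton_iff] at h1
  exact (corner_injective hq w h1).symm

theorem measurableSet_B (hv : NeighborWords q w v a) (hq : IsEquilateral q) (c : Fin 3 → ℝ) :
    MeasurableSet (B q w c) :=
  (isCompact_cell q w).isClosed.measurableSet.union
    (MeasurableSet.iUnion fun i => hv.measurableSet_E hq i (c i))

theorem B_subset_SG (hv : NeighborWords q w v a) (hq : IsEquilateral q) (c : Fin 3 → ℝ) :
    B q w c ⊆ SG q :=
  union_subset (cell_subset_SG q w)
    (iUnion_subset fun i => (hv.E_subset hq i _).trans (cell_subset_SG q _))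

theorem B_subset_D (hv : NeighborWords q w v a) (hq : IsEquilateral q) (c : Fin 3 → ℝ) :
    B q w c ⊆ D q w := by
  refine union_subset_union_right _ (iUnion_mono fun i => ?_)
  refine (hv.E_subset hq i (c i)).trans ?_
  exact subset_iUnion₂_of_subset (v i) ((hv.isNeighbor_iff i _).2 rfl) Subset.rfl

/-- Harmonicity at $p_i$ replaces the corner sum over the neighbor by $6h(p_i)$ minus the corner sum
over $C_w$, so only values on $C_w$ remain. -/
theorem setIntegral_E (hv : NeighborWords q w v a) (hq : IsEquilateral q) {h : Plane → ℝ}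
    (hh : IsHarmonic q h) (i : Fin 3) (c : ℝ) :
    ∫ x in E q w i c, h x ∂mu q = (1 / 3) ^ w.length * (mass c * h (corner q w i) +
      moment c * ((3 * h (corner q w i) - ∑ j, h (corner q w j)) / 2)) := by
  have h1 := hv.sum_extendWord i fun i => h (q i)
  rw [hv.E_eq hq, setIntegral_lowerPart hq hh, hv.length_eq, cutIntegral_eq, hv.extendWord_eq]
  simp only [hh.corner hq]
  linear_combination (1 / 3) ^ w.length * moment c / 2 * h1

theorem setIntegral_B (hv : NeighborWords q w v a) (hq : IsEquilateral q) {h : Plane → ℝ}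
    (hh : IsHarmonic q h) (c : Fin 3 → ℝ) :
    ∫ x in B q w c, h x ∂mu q =
      (1 / 3) ^ w.length * (totalMass c * ∑ i, coeff c i * h (corner q w i)) := by
  have hint : ∀ s, IntegrableOn h s (mu q) := fun s => (integrable_of_continuousOn hh.1).integrableOn
  have hm := hv.measurableSet_E hq
  have hd1 : AEDisjoint (mu q) (cell q w) (⋃ i, E q w i (c i)) := by
    rw [AEDisjoint.iUnion_right_iff]
    exact fun i => measure_mono_null (inter_subset_inter_right _ (hv.E_subset hq i _))
      (hv.mu_cell_inter hq i)
  have hd2 : Pairwise (Function.onFun (AEDisjoint (mu q)) fun i => E q w i (c i)) :=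
    fun i j hij => measure_mono_null
      (inter_subset_inter (hv.E_subset hq i _) (hv.E_subset hq j _)) (hv.mu_inter hq hij)
  rw [B, setIntegral_union₀ hd1 (MeasurableSet.iUnion fun i => hm i (c i)).nullMeasurableSet
    (hint _) (hint _), integral_iUnion_ae (fun i => (hm i (c i)).nullMeasurableSet) hd2 (hint _),
    tsum_fintype, setIntegral_cell hq hh]
  simp only [hv.setIntegral_E hq hh, Fin.sum_univ_three, coeff, ratio, weight]
  have ht := (totalMass_pos c).ne'
  field_simp
  rw [totalMass, Fin.sum_univ_three]
  ring

theorem measureReal_B (hv : NeighborWords q w v a) (hq : IsEquilateral q) (c : Fin 3 → ℝ) :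
    (mu q).real (B q w c) = (1 / 3) ^ w.length * totalMass c := by
  have h1 : ∑ i, coeff c i = 1 := coeff_mem_planeW c
  rw [measureReal_eq_setIntegral hq (hv.measurableSet_B hq c) (hv.B_subset_SG hq c),
    hv.setIntegral_B hq (isHarmonic_harmonicExt hq _)]
  simp only [harmonicExt_one hq (cell_subset_SG q w (corner_mem_cell q w _)), mul_one, h1]

theorem isCoeff_iff (hv : NeighborWords q w v a) (hq : IsEquilateral q) (c b : Fin 3 → ℝ) :
    IsCoeff q w (B q w c) b ↔ b = coeff c := by
  have hc : IsCoeff q w (B q w c) (coeff c) := by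
    intro h hh
    have ht := (totalMass_pos c).ne'
    rw [setAverage_eq, hv.measureReal_B hq, hv.setIntegral_B hq hh, smul_eq_mul]
    field_simp
  refine ⟨fun hb => ?_, fun hb => hb ▸ hc⟩
  funext j
  -- Every triple of values at the $p_i$ comes from a harmonic function; the unit triples isolate
  -- the coefficients.
  obtain ⟨k, hk⟩ := extendWord_surjective w (Pi.single j 1)
  have h1 := (hb _ (isHarmonic_harmonicExt hq k)).symm.trans (hc _ (isHarmonic_harmonicExt hq k))
  simpa [harmonicExt_corner hq, hk, Pi.single_apply] using h1

theorem measureReal_E (hv : NeighborWords q w v a) (hq : IsEquilateral q) (i : Fin 3) (c : ℝ) :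
    (mu q).real (E q w i c) = (1 / 3) ^ w.length * mass c := by
  rw [measureReal_eq_setIntegral hq (hv.measurableSet_E hq i c)
    ((hv.E_subset hq i c).trans (cell_subset_SG q _)),
    hv.setIntegral_E hq (isHarmonic_harmonicExt hq _)]
  simp only [harmonicExt_one hq (cell_subset_SG q w (corner_mem_cell q w _)), Fin.sum_univ_three]
  ring

theorem measureReal_B_inter (hv : NeighborWords q w v a) (hq : IsEquilateral q) (c : Fin 3 → ℝ)
    (i : Fin 3) : (mu q).real (B q w c ∩ cell q (v i)) = (1 / 3) ^ w.length * mass (c i) := by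
  rw [← hv.measureReal_E hq i]
  refine measureReal_congr (Filter.EventuallyLE.antisymm ?_ (LE.le.eventuallyLE ?_))
  · have h0 : mu q ((cell q w ∩ cell q (v i)) ∪ ⋃ (j : Fin 3) (_ : j ≠ i),
        (cell q (v j) ∩ cell q (v i))) = 0 :=
      measure_union_null (hv.mu_cell_inter hq i)
        (measure_iUnion_null fun j => measure_iUnion_null fun hj => hv.mu_inter hq hj)
    rw [ae_le_set]
    refine measure_mono_null ?_ h0
    rintro x ⟨⟨hx | hx, hxi⟩, hxE⟩
    · exact Or.inl ⟨hx, hxi⟩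
    · obtain ⟨j, hj⟩ := mem_iUnion.1 hx
      have hji : j ≠ i := fun h => hxE (h ▸ hj)
      exact Or.inr (mem_iUnion₂.2 ⟨j, hji, hv.E_subset hq j _ hj, hxi⟩)
  · exact subset_inter (subset_union_of_subset_right (subset_iUnion (fun i => E q w i (c i)) i) _)
      (hv.E_subset hq i _)

/-- The mass of $B(c)\cap C_i$ recovers `mass (c i)`, since the other pieces meet $C_i$ in null
sets. -/
theorem injOn_B (hv : NeighborWords q w v a) (hq : IsEquilateral q) : InjOn (B q w) Lam := by
  intro c hc c' hc' h
  funext i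
  refine mass_strictMonoOn.injOn (hc i) (hc' i) ?_
  have h1 := hv.measureReal_B_inter hq c i
  rw [h, hv.measureReal_B_inter hq c' i] at h1
  exact (mul_left_cancel₀ (by positivity) h1).symm

end NeighborWords

end SGasket

open SGasket in
theorem theorem3p1 (q : Fin 3 → Plane) (hq : IsEquilateral q) :
    ∃ Wt : Set (Fin 3 → ℝ), stdSimplex ℝ (Fin 3) ⊆ Wt ∧ Wt ⊆ planeW ∧
      ∀ w : List (Fin 3), cell q w ∩ V q 0 = ∅ →
        (∀ i, ∃! v, IsNeighbor q w i v) ∧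
        Set.InjOn (B q w) Lam ∧
        (∀ S ∈ family q w, cell q w ⊆ S ∧ S ⊆ D q w) ∧
        ∃ T : Set Plane → Fin 3 → ℝ,
          (∀ S ∈ family q w, ∀ a : Fin 3 → ℝ, IsCoeff q w S a ↔ a = T S) ∧
          T '' family q w = Wt ∧
          Set.BijOn T (familyStar q w) Wt := by
  refine ⟨coeff '' Lam, stdSimplex_subset_coeff_image, ?_, fun w hw => ?_⟩
  · rintro _ ⟨c, -, rfl⟩
    exact coeff_mem_planeW c
  obtain ⟨v, a, hv⟩ := exists_neighborWords hq hw
  have hinj := hv.injOn_B hq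
  refine ⟨fun i => ⟨v i, (hv.isNeighbor_iff i _).2 rfl, fun v' h => (hv.isNeighbor_iff i v').1 h⟩,
    hinj, ?_, ?_⟩
  · rintro _ ⟨c, -, rfl⟩
    exact ⟨subset_union_left, hv.B_subset_D hq c⟩
  -- Injectivity of $c\mapsto B(c)$ makes $\mathcal T$ a function of the set: it reads off the
  -- parameter and applies `coeff`.
  have hT : ∀ c ∈ Lam, coeff (Function.invFunOn (B q w) Lam (B q w c)) = coeff c := fun c hc => by
    rw [hinj.leftInvOn_invFunOn hc]
  refine ⟨fun S => coeff (Function.invFunOn (B q w) Lam S), ?_, ?_, ?_, ?_, ?_⟩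
  · rintro _ ⟨c, hc, rfl⟩ b
    simp only [hT c hc]
    exact hv.isCoeff_iff hq c b
  · rw [family, image_image]
    exact image_congr hT
  · rintro _ ⟨c, hc, rfl⟩
    exact ⟨c, hc.1, (hT c hc.1).symm⟩
  · rintro _ ⟨c, hc, rfl⟩ _ ⟨c', hc', rfl⟩ h
    simp only [hT c hc.1, hT c' hc'.1] at h
    rw [coeff_injOn hc hc' h]
  · rw [← coeff_image_LamStar]
    rintro _ ⟨c, hc, rfl⟩
    exact ⟨B q w c, ⟨c, hc, rfl⟩, hT c hc.1⟩
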